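/- There is an absolute constant $C>0$ such that the following holds. Let $n\ge 2$ be an integer and let $p$ be a real number with $(\log n)^{-1/4}\le p\le 1-(\log n)^{-1/4}$. Let $m\in\mathbb{Z}$ satisfy $|m|\le 2(\log n)^{1/4}$. For each $k\in\{1,\dots,n+m\}$ let $\tau_k,\tau_k'\in\mathbb{Z}$ with $|\tau_k|,|\tau_k'|\le 2(\log n)^{1/4}$, let $q_k,q_k'\in[0,1]$ with \[|q_k-p|,\ |q_k'-p|\le \frac{40\sqrt{p(1-p)\log n}}{n},\] and let $\epsilon_k\in\{1,-1\}$. For each $k$, let $X_k\sim\operatorname{Bin}(n+\tau_k,q_k)$ and $Y_k\sim\operatorname{Bin}(n+\tau_k',q_k')$ be independent, let $X_k^-$ have the law of $X_k$ conditional on $X_k\le Y_k$, and let $X_k^+$ have the law of $X_k$ conditional on $X_k>Y_k$. Let $1\le i\le n+m$ and \[S=\sum_{k=1}^{i}\epsilon_kX_k^-+\sum_{k=i+1}^{n+m}\epsilon_kX_k^+,\] where the $n+m$ summands are independent. Let $\mu_S$ be the mean of $S$ and $\sigma_S\ge 0$ its standard deviation. Then for every $s\in\mathbb{Z}$, \[\left|\mathbb{P}[S=s]-\frac{1}{\sqrt{2\pi}\,\sigma_S}\exp\left(-\frac{(s-\mu_S)^2}{2\sigma_S^2}\right)\right|\le\frac{C}{n^{1/5}\sigma_S}.\]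 -/

import Mathlib

open MeasureTheory ProbabilityTheory

/-- The law of `X` conditional on `X ≤ Y`, where `X ∼ Bin(N, q)` and `Y ∼ Bin(N', q')` are
independent. -/
noncomputable def binomialCondLE (N N' : ℕ) (q q' : unitInterval) : Measure ℕ :=
  (cond ((binomial N q).prod (binomial N' q')) {z : ℕ × ℕ | z.1 ≤ z.2}).map Prod.fst

/-- The law of `X` conditional on `X > Y`, where `X ∼ Bin(N, q)` and `Y ∼ Bin(N', q')` are
independent. -/
noncomputable def binomialCondGT (N N' : ℕ) (q q' : unitInterval) : Measure ℕ :=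
  (cond ((binomial N q).prod (binomial N' q')) {z : ℕ × ℕ | z.1 > z.2}).map Prod.fst

/-- The signed sum `∑ k, ε k * X k`, an integer-valued random variable. -/
def signedSum {Ω : Type*} {N : ℕ} (ε : Fin N → ℤ) (X : Fin N → Ω → ℕ) (ω : Ω) : ℤ :=
  ∑ k, ε k * (X k ω : ℤ)

/-! The law of an integer variable is recovered from its characteristic function on [-π, π], so it
suffices to compare the characteristic function of S - μ_S with exp(-σ²t²/2);
`norm_integral_sub_gaussian_le` turns such a comparison into a local limit estimate. The frequency
range is split at T = n^(-0.95).

For |t| ≤ T, each factor is close to its Gaussian counterpart by a third-moment Taylor bound, and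
the errors add up over the product. Third moments are O(n^(3/2)), so this range costs O(T · n · T³ ·
n^(3/2)) = O(n^(-1.3)).

For T ≤ |t| ≤ π, decay comes from flatness. If w is the standard deviation of the unconditioned
binomial, each summand has mass at least a constant over w on a run of consecutive integers of
length comparable to w. Splitting off that uniform piece bounds its characteristic function by 1 - c
min(1, (wt)²) (`norm_integral_cexp_nat_le`). Since w ≥ 32 n^(0.49) for large n, about n factors
multiply to at most exp(-c n^(0.08)). The Gaussian tail is equally small because σ² is at least of
order n^(1.98). As σ = O(n), every error is O(n^(-1/5) / σ).

Conditioning costs only constants. The two binomial means differ by much less than a standard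
deviation, so X ≤ Y and X > Y both have probability at least 1/400; moments grow at most 400-fold,
and the mass at a is at least P(X = a) P(a ≤ Y), respectively P(X = a) P(Y < a). The flat runs
(`binomialCondLE_window`, `binomialCondGT_window`) come from a fourth-moment Paley–Zygmund bound, a
pigeonhole step and unimodality of the binomial. -/

/-! ### Fourier inversion and comparison with the Gaussian -/

lemma integral_cexp_int_mul (k : ℤ) :
    ∫ t in -Real.pi..Real.pi, Complex.exp (t * k * Complex.I) =
      if k = 0 then (2 * Real.pi : ℂ) else 0 := by
  split_ifs with h
  · subst h
    simp
    ring
  · have hc : (k : ℂ) * Complex.I ≠ 0 := by simp [h]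
    have := integral_exp_mul_complex (a := -Real.pi) (b := Real.pi) hc
    simp_rw [mul_assoc, mul_comm _ ((k : ℂ) * Complex.I)]
    rw [this, div_eq_zero_iff]
    left
    rw [sub_eq_zero, Complex.exp_eq_exp_iff_exists_int]
    exact ⟨k, by push_cast; ring⟩

/-- Fourier inversion for a probability measure on the integers. -/
lemma measureReal_singleton_eq_integral (ν : Measure ℤ) [IsProbabilityMeasure ν] (s : ℤ) :
    (ν.real {s} : ℂ) = 1 / (2 * Real.pi) *
      ∫ t in -Real.pi..Real.pi, ∫ x : ℤ, Complex.exp (t * ((x : ℂ) - s) * Complex.I) ∂ν := by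
  have hpi : -Real.pi ≤ Real.pi := by linarith [Real.pi_pos]
  rw [intervalIntegral.integral_of_le hpi, integral_integral_swap]
  · simp_rw [← intervalIntegral.integral_of_le hpi]
    have (x : ℤ) : ∫ t in -Real.pi..Real.pi, Complex.exp (t * ((x : ℂ) - s) * Complex.I) =
        Set.indicator {s} (fun _ => (2 * Real.pi : ℂ)) x := by
      have := integral_cexp_int_mul (x - s)
      push_cast at this
      rw [this]
      simp [Set.indicator_apply, sub_eq_zero]
    simp_rw [this]
    rw [integral_indicator_const _ (measurableSet_singleton s)]
    have : (Real.pi : ℂ) ≠ 0 := by exact_mod_cast Real.pi_ne_zero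
    rw [Complex.real_smul]
    field_simp
  · refine (integrable_const (1 : ℝ)).mono' ?_ (.of_forall fun z => ?_)
    · refine Measurable.aestronglyMeasurable ?_
      have : Measurable fun z : ℝ × ℤ => ((z.2 : ℤ) : ℂ) :=
        (measurable_of_countable (fun x : ℤ => (x : ℂ))).comp measurable_snd
      simp only [Function.uncurry_def]
      fun_prop
    · have : (z.1 * ((z.2 : ℂ) - s) * Complex.I) = ((z.1 * (z.2 - s) : ℝ) : ℂ) * Complex.I := by
        push_cast; ring
      simp only [Function.uncurry_def]
      rw [this, Complex.norm_exp_ofReal_mul_I]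

lemma measureReal_eq_integral_charFun {Ω : Type*} [MeasurableSpace Ω] (P : Measure Ω)
    [IsProbabilityMeasure P] {S : Ω → ℤ} (hS : AEMeasurable S P) (μ : ℝ) (s : ℤ) :
    (P.real {ω | S ω = s} : ℂ) = 1 / (2 * Real.pi) * ∫ t in -Real.pi..Real.pi,
      charFun (P.map fun ω => (S ω : ℝ) - μ) t *
        Complex.exp (-(t * ((s : ℂ) - μ)) * Complex.I) := by
  have : IsProbabilityMeasure (P.map S) := Measure.isProbabilityMeasure_map hS
  have h1 : P.real {ω | S ω = s} = (P.map S).real {s} := by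
    rw [map_measureReal_apply_of_aemeasurable hS (measurableSet_singleton s)]; rfl
  have hm : Measurable fun x : ℤ => (x : ℝ) - μ := measurable_of_countable _
  have hS' : AEMeasurable (fun ω => (S ω : ℝ) - μ) P := hm.comp_aemeasurable hS
  rw [h1, measureReal_singleton_eq_integral]
  congr 1
  refine intervalIntegral.integral_congr fun t _ => ?_
  rw [charFun_apply_real, integral_map hS' (by fun_prop), integral_map hS
    (measurable_of_countable _).aestronglyMeasurable, ← integral_mul_const]
  congr 1
  ext ω
  rw [← Complex.exp_add]
  congr 1
  push_cast
  ring

lemma integral_gaussian_mul_cexp {σ : ℝ} (hσ : 0 < σ) (x : ℝ) :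
    (1 / (2 * Real.pi) : ℂ) * ∫ t : ℝ, ((Real.exp (-σ ^ 2 * t ^ 2 / 2) : ℝ) : ℂ) *
        Complex.exp (-(t * (x : ℂ)) * Complex.I) =
      ((1 / (√(2 * Real.pi) * σ) * Real.exp (-x ^ 2 / (2 * σ ^ 2)) : ℝ) : ℂ) := by
  have hb : 0 < ((σ ^ 2 / 2 : ℝ) : ℂ).re := by
    rw [Complex.ofReal_re]; positivity
  have h := fourierIntegral_gaussian hb (-x : ℂ)
  have e : ∀ t : ℝ, ((Real.exp (-σ ^ 2 * t ^ 2 / 2) : ℝ) : ℂ) *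
        Complex.exp (-(t * (x : ℂ)) * Complex.I) =
      Complex.exp (Complex.I * (-x : ℂ) * t) *
        Complex.exp (-((σ ^ 2 / 2 : ℝ) : ℂ) * t ^ 2) := by
    intro t
    rw [Complex.ofReal_exp, ← Complex.exp_add, ← Complex.exp_add]
    congr 1
    push_cast
    ring
  simp_rw [e]
  rw [h]
  have h2 : ((Real.pi : ℂ) / ((σ ^ 2 / 2 : ℝ) : ℂ)) ^ (1 / 2 : ℂ) =
      ((√(2 * Real.pi) / σ : ℝ) : ℂ) := by
    have h3 : (0 : ℝ) ≤ Real.pi / (σ ^ 2 / 2) := by positivity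
    have h4 := Complex.ofReal_cpow h3 (1 / 2)
    have h5 : √(2 * Real.pi) / σ = (Real.pi / (σ ^ 2 / 2)) ^ (1 / 2 : ℝ) := by
      rw [← Real.sqrt_eq_rpow]
      rw [show Real.pi / (σ ^ 2 / 2) = (2 * Real.pi) / σ ^ 2 by field_simp,
        Real.sqrt_div (by positivity), Real.sqrt_sq hσ.le]
    rw [h5, h4]
    push_cast
    rfl
  rw [h2]
  have h6 : √(2 * Real.pi) * √(2 * Real.pi) = 2 * Real.pi :=
    Real.mul_self_sqrt (by positivity)
  have h7 : Complex.exp (-(-x : ℂ) ^ 2 / (4 * ((σ ^ 2 / 2 : ℝ) : ℂ))) =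
      ((Real.exp (-x ^ 2 / (2 * σ ^ 2)) : ℝ) : ℂ) := by
    rw [Complex.ofReal_exp]
    congr 1
    push_cast
    ring
  rw [h7]
  have h8 : 1 / (√(2 * Real.pi) * σ) = 1 / (2 * Real.pi) * (√(2 * Real.pi) / σ) := by
    have h9 : 1 / (2 * Real.pi) = 1 / (√(2 * Real.pi) * √(2 * Real.pi)) := by rw [h6]
    have : 0 < √(2 * Real.pi) := by have := Real.pi_pos; positivity
    rw [h9]
    field_simp
  rw [h8]
  push_cast
  ring

/-- The quantitative comparison behind a local limit theorem. -/
lemma norm_integral_sub_gaussian_le {ψ : ℝ → ℂ} (hψ : Continuous ψ) {σ T A B : ℝ}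
    (hσ : 0 < σ) (hT : 0 < T) (hTpi : T ≤ Real.pi) (hB : 0 ≤ B)
    (h1 : ∀ t : ℝ, |t| ≤ T → ‖ψ t - (Real.exp (-σ ^ 2 * t ^ 2 / 2) : ℝ)‖ ≤ A)
    (h2 : ∀ t : ℝ, T ≤ |t| → |t| ≤ Real.pi → ‖ψ t‖ ≤ B) (x : ℝ) :
    ‖(1 / (2 * Real.pi) : ℂ) * (∫ t in -Real.pi..Real.pi,
        ψ t * Complex.exp (-(t * (x : ℂ)) * Complex.I)) -
      ((1 / (√(2 * Real.pi) * σ) * Real.exp (-x ^ 2 / (2 * σ ^ 2)) : ℝ) : ℂ)‖ ≤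
      T * A + B + Real.exp (-σ ^ 2 * T ^ 2 / 4) / σ := by
  have hpi := Real.pi_pos
  have hA : 0 ≤ A := (norm_nonneg _).trans (h1 0 (by simpa using hT.le))
  have he : ∀ t : ℝ, ‖Complex.exp (-(t * (x : ℂ)) * Complex.I)‖ = 1 := by
    intro t
    rw [show (-(t * (x : ℂ)) * Complex.I) = ((-(t * x) : ℝ) : ℂ) * Complex.I by push_cast; ring,
      Complex.norm_exp_ofReal_mul_I]
  set g : ℝ → ℂ := fun t => ((Real.exp (-σ ^ 2 * t ^ 2 / 2) : ℝ) : ℂ) with hg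
  set e : ℝ → ℂ := fun t => Complex.exp (-(t * (x : ℂ)) * Complex.I) with hedef
  have hec : Continuous e := by fun_prop
  have hgc : Continuous g := by fun_prop
  have hgn : ∀ t, ‖g t‖ = Real.exp (-(σ ^ 2 / 2) * t ^ 2) := by
    intro t
    rw [hg, Complex.norm_real, Real.norm_eq_abs, Real.abs_exp]
    congr 1; ring
  have hgi : Integrable (fun t => g t * e t) := by
    refine (integrable_exp_neg_mul_sq (b := σ ^ 2 / 2) (by positivity)).mono'
      (by fun_prop) (.of_forall fun t => ?_)
    rw [norm_mul, he, mul_one, hgn]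
  have hψi : IntegrableOn (fun t => ψ t * e t) (Set.Ioc (-Real.pi) Real.pi) := by
    rw [← intervalIntegrable_iff_integrableOn_Ioc_of_le (by linarith)]
    exact (by fun_prop : Continuous fun t => ψ t * e t).intervalIntegrable _ _
  rw [← integral_gaussian_mul_cexp hσ x, intervalIntegral.integral_of_le (by linarith),
    ← integral_indicator measurableSet_Ioc, ← mul_sub, ← integral_sub
    ((integrable_indicator_iff measurableSet_Ioc).2 hψi) hgi, norm_mul]
  have hn : ‖(1 / (2 * Real.pi) : ℂ)‖ = 1 / (2 * Real.pi) := by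
    rw [norm_div, norm_mul, Complex.norm_real, Real.norm_of_nonneg hpi.le]; simp
  rw [hn]
  -- Integrable majorant of the difference of integrands: A on the inner range, B on the outer
  -- range, and a Gaussian tail. The tail uses σ²t²/2 ≥ σ²T²/4 + σ²t²/4 for |t| ≥ T, which keeps an
  -- integrable factor after extracting the small constant.
  set b : ℝ → ℝ := fun t => (Set.Icc (-T) T).indicator (fun _ => A) t +
    (Set.Icc (-Real.pi) Real.pi).indicator (fun _ => B) t +
    Real.exp (-σ ^ 2 * T ^ 2 / 4) * Real.exp (-(σ ^ 2 / 4) * t ^ 2) with hb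
  have hbi1 : Integrable ((Set.Icc (-T) T).indicator (fun _ => A)) :=
    (integrable_indicator_iff measurableSet_Icc).2 (by simp)
  have hbi2 : Integrable ((Set.Icc (-Real.pi) Real.pi).indicator (fun _ => B)) :=
    (integrable_indicator_iff measurableSet_Icc).2 (by simp)
  have hbi3 : Integrable fun t : ℝ =>
      Real.exp (-σ ^ 2 * T ^ 2 / 4) * Real.exp (-(σ ^ 2 / 4) * t ^ 2) :=
    (integrable_exp_neg_mul_sq (by positivity)).const_mul _
  have key : ‖∫ t, ((Set.Ioc (-Real.pi) Real.pi).indicator (fun t => ψ t * e t) t - g t * e t)‖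
      ≤ ∫ t, b t := by
    refine norm_integral_le_of_norm_le ((hbi1.add hbi2).add hbi3) (.of_forall fun t => ?_)
    have hb0 : 0 ≤ (Set.Icc (-Real.pi) Real.pi).indicator (fun _ => B) t :=
      Set.indicator_nonneg (fun _ _ => hB) t
    have hc0 : 0 ≤ Real.exp (-σ ^ 2 * T ^ 2 / 4) * Real.exp (-(σ ^ 2 / 4) * t ^ 2) := by
      positivity
    have htail : T ≤ |t| → ‖g t * e t‖ ≤
        Real.exp (-σ ^ 2 * T ^ 2 / 4) * Real.exp (-(σ ^ 2 / 4) * t ^ 2) := by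
      intro ht
      rw [norm_mul, he, mul_one, hgn, ← Real.exp_add]
      apply Real.exp_le_exp.2
      have : T ^ 2 ≤ t ^ 2 := by
        rw [← sq_abs t]; gcongr
      nlinarith [sq_nonneg σ]
    by_cases hIoc : t ∈ Set.Ioc (-Real.pi) Real.pi
    · rw [Set.indicator_of_mem hIoc]
      by_cases hTt : |t| ≤ T
      · have h3 : ‖ψ t * e t - g t * e t‖ ≤ A := by
          rw [← sub_mul, norm_mul, he, mul_one]; exact h1 t hTt
        have h4 : (Set.Icc (-T) T).indicator (fun _ => A) t = A :=
          Set.indicator_of_mem (Set.mem_Icc.2 (abs_le.1 hTt)) _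
        simp only [hb, h4]
        linarith
      · push Not at hTt
        have h4 : (Set.Icc (-T) T).indicator (fun _ => A) t = 0 :=
          Set.indicator_of_notMem
            (fun h => absurd (abs_le.2 (Set.mem_Icc.1 h)) (not_le.2 hTt)) _
        have h5 : (Set.Icc (-Real.pi) Real.pi).indicator (fun _ => B) t = B :=
          Set.indicator_of_mem (Set.mem_Icc.2 ⟨hIoc.1.le, hIoc.2⟩) _
        have h6 : ‖ψ t * e t‖ ≤ B := by
          rw [norm_mul, he, mul_one]
          exact h2 t hTt.le (abs_le.2 ⟨hIoc.1.le, hIoc.2⟩)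
        have := norm_sub_le (ψ t * e t) (g t * e t)
        have := htail hTt.le
        simp only [hb, h4, h5]
        linarith
    · rw [Set.indicator_of_notMem hIoc, zero_sub, norm_neg]
      have hTt : T ≤ |t| := by
        by_contra hlt
        push Not at hlt
        rw [abs_lt] at hlt
        exact hIoc ⟨by linarith, by linarith⟩
      have := htail hTt
      have : 0 ≤ (Set.Icc (-T) T).indicator (fun _ => A) t :=
        Set.indicator_nonneg (fun _ _ => hA) t
      simp only [hb]
      linarith
  have hint : ∫ t, b t = 2 * T * A + 2 * Real.pi * B +
      Real.exp (-σ ^ 2 * T ^ 2 / 4) * √(Real.pi / (σ ^ 2 / 4)) := by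
    simp only [hb]
    have h12 : Integrable fun t => (Set.Icc (-T) T).indicator (fun _ => A) t +
        (Set.Icc (-Real.pi) Real.pi).indicator (fun _ => B) t := hbi1.add hbi2
    rw [integral_add h12 hbi3, integral_add hbi1 hbi2,
      integral_indicator_const _ measurableSet_Icc, integral_indicator_const _ measurableSet_Icc,
      integral_const_mul, integral_gaussian]
    simp only [Real.volume_real_Icc, smul_eq_mul]
    rw [max_eq_left (by linarith), max_eq_left (by linarith)]
    ring
  rw [hint] at key
  have hs : √(Real.pi / (σ ^ 2 / 4)) ≤ 2 * Real.pi / σ := by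
    rw [show Real.pi / (σ ^ 2 / 4) = Real.pi * (2 / σ) ^ 2 by field_simp; norm_num,
      Real.sqrt_mul hpi.le, Real.sqrt_sq (by positivity)]
    have : √Real.pi ≤ Real.pi := Real.sqrt_le_iff.2 ⟨hpi.le, by nlinarith [Real.pi_gt_three]⟩
    calc √Real.pi * (2 / σ) ≤ Real.pi * (2 / σ) := by gcongr
      _ = _ := by ring
  calc _ ≤ 1 / (2 * Real.pi) * (2 * T * A + 2 * Real.pi * B +
      Real.exp (-σ ^ 2 * T ^ 2 / 4) * (2 * Real.pi / σ)) := by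
        gcongr
        exact key.trans (by gcongr)
    _ = T * A / Real.pi + B + Real.exp (-σ ^ 2 * T ^ 2 / 4) / σ := by
        field_simp
    _ ≤ _ := by
        gcongr
        exact div_le_self (by positivity) (by linarith [Real.pi_gt_three])

/-! ### Characteristic functions near the origin -/

lemma norm_prod_sub_prod_le_sum {ι : Type*} (s : Finset ι) {a b : ι → ℂ}
    (ha : ∀ k ∈ s, ‖a k‖ ≤ 1) (hb : ∀ k ∈ s, ‖b k‖ ≤ 1) :
    ‖∏ k ∈ s, a k - ∏ k ∈ s, b k‖ ≤ ∑ k ∈ s, ‖a k - b k‖ := by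
  classical
  induction s using Finset.induction_on with
  | empty => simp
  | insert k s hk ih =>
    rw [Finset.prod_insert hk, Finset.prod_insert hk, Finset.sum_insert hk]
    have h1 := ih (fun j hj => ha j (Finset.mem_insert_of_mem hj))
      (fun j hj => hb j (Finset.mem_insert_of_mem hj))
    have h2 : ‖∏ j ∈ s, a j‖ ≤ 1 := by
      rw [norm_prod]
      exact Finset.prod_le_one (fun _ _ => norm_nonneg _)
        (fun j hj => ha j (Finset.mem_insert_of_mem hj))
    calc _ = ‖(a k - b k) * ∏ j ∈ s, a j + b k * (∏ j ∈ s, a j - ∏ j ∈ s, b j)‖ := by ring_nf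
      _ ≤ ‖a k - b k‖ * 1 + 1 * ∑ j ∈ s, ‖a j - b j‖ := by
        refine (norm_add_le _ _).trans ?_
        rw [norm_mul, norm_mul]
        gcongr
        exact hb k (Finset.mem_insert_self _ _)
      _ = _ := by ring

lemma norm_cexp_mul_I_sub_taylor_le (x : ℝ) :
    ‖Complex.exp (x * Complex.I) - (1 + x * Complex.I - x ^ 2 / 2)‖ ≤ 4 * |x| ^ 3 := by
  have hx : ‖(x * Complex.I : ℂ)‖ = |x| := by simp
  by_cases h : |x| ≤ 1
  · have := Complex.norm_exp_sub_sum_le_norm_mul_exp (x * Complex.I) 3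
    rw [hx] at this
    simp only [Finset.sum_range_succ, Finset.range_zero, Finset.sum_empty] at this
    have e : (1 + x * Complex.I - x ^ 2 / 2 : ℂ) = 0 + (x * Complex.I) ^ 0 / (Nat.factorial 0 : ℂ)
        + (x * Complex.I) ^ 1 / (Nat.factorial 1 : ℂ)
        + (x * Complex.I) ^ 2 / (Nat.factorial 2 : ℂ) := by
      simp [Nat.factorial, mul_pow]
      ring
    rw [e]
    refine this.trans ?_
    have : Real.exp |x| ≤ 4 := by
      have := Real.exp_le_exp.2 h
      have := Real.exp_one_lt_d9
      linarith
    nlinarith [pow_nonneg (abs_nonneg x) 3]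
  · push Not at h
    have h1 : ‖(1 + x * Complex.I - x ^ 2 / 2 : ℂ)‖ ≤ 1 + |x| + |x| ^ 2 / 2 := by
      refine (norm_sub_le _ _).trans (add_le_add ((norm_add_le _ _).trans ?_) ?_)
      · rw [hx]; simp
      · simp
    have h2 := norm_sub_le (Complex.exp (x * Complex.I)) (1 + x * Complex.I - x ^ 2 / 2)
    rw [Complex.norm_exp_ofReal_mul_I] at h2
    have h3 : 1 ≤ |x| ^ 3 := one_le_pow₀ h.le
    have h4 : |x| ≤ |x| ^ 3 := le_self_pow₀ h.le (by norm_num)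
    have h5 : |x| ^ 2 ≤ |x| ^ 3 := pow_le_pow_right₀ h.le (by norm_num)
    linarith

/-- The upper half is exp(-y) ≤ 1/(1 + y) ≤ 1 - y + y², the latter because (1 + y)(1 - y + y²) = 1 +
y³. -/
lemma abs_exp_neg_sub_le {y : ℝ} (hy : 0 ≤ y) : |Real.exp (-y) - (1 - y)| ≤ y ^ 2 := by
  have h1 := Real.add_one_le_exp (-y)
  have h2 := Real.add_one_le_exp y
  rw [abs_of_nonneg (by linarith)]
  have h3 : Real.exp (-y) ≤ 1 - y + y ^ 2 := by
    rw [Real.exp_neg, inv_le_comm₀ (Real.exp_pos _) (by nlinarith)]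
    refine le_trans ?_ h2
    rw [inv_le_iff_one_le_mul₀ (by nlinarith)]
    nlinarith [pow_nonneg hy 3]
  linarith

section

variable {Ω : Type*} [MeasurableSpace Ω] {P : Measure Ω} [IsProbabilityMeasure P]

/-- Both functions are compared with 1 - vt²/2. For the characteristic function the Taylor bound is
integrated, the linear term vanishing by centring; for the exponential the error is quadratic in
vt²/2. -/
lemma norm_charFun_sub_exp_le {Z : Ω → ℝ} (hZ : MemLp Z 3 P) (h0 : ∫ ω, Z ω ∂P = 0) (t : ℝ) :
    ‖charFun (P.map Z) t - (Real.exp (-(∫ ω, Z ω ^ 2 ∂P) * t ^ 2 / 2) : ℝ)‖ ≤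
      4 * |t| ^ 3 * ∫ ω, |Z ω| ^ 3 ∂P + (∫ ω, Z ω ^ 2 ∂P) ^ 2 * t ^ 4 := by
  set v := ∫ ω, Z ω ^ 2 ∂P
  have hv : 0 ≤ v := integral_nonneg fun _ => sq_nonneg _
  have hm : AEMeasurable Z P := hZ.1.aemeasurable
  have i1 : Integrable Z P := hZ.integrable (by norm_num)
  have i2 : Integrable (fun ω => Z ω ^ 2) P :=
    (hZ.mono_exponent (by norm_num)).integrable_sq
  have i3 : Integrable (fun ω => |Z ω| ^ 3) P := hZ.integrable_norm_pow (by norm_num)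
  have ie : Integrable (fun ω => Complex.exp (((t * Z ω : ℝ) : ℂ) * Complex.I)) P := by
    refine (integrable_const (1 : ℝ)).mono' ?_ (.of_forall fun ω => ?_)
    · exact (by fun_prop : AEMeasurable (fun ω => Complex.exp (((t * Z ω : ℝ) : ℂ) * Complex.I))
        P).aestronglyMeasurable
    · rw [Complex.norm_exp_ofReal_mul_I]
  have iq : Integrable (fun ω => (1 + ((t * Z ω : ℝ) : ℂ) * Complex.I
      - ((t * Z ω : ℝ) : ℂ) ^ 2 / 2)) P := by
    have j1 : Integrable (fun ω => ((t * Z ω : ℝ) : ℂ)) P := (i1.const_mul t).ofReal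
    have j2 : Integrable (fun ω => (((t * Z ω) ^ 2 : ℝ) : ℂ)) P := by
      simp_rw [mul_pow]
      exact (i2.const_mul (t ^ 2)).ofReal
    push_cast at j1 j2 ⊢
    exact ((integrable_const _).add (j1.mul_const _)).sub (j2.div_const 2)
  have hq : ∫ ω, (1 + ((t * Z ω : ℝ) : ℂ) * Complex.I - ((t * Z ω : ℝ) : ℂ) ^ 2 / 2) ∂P =
      ((1 - v * t ^ 2 / 2 : ℝ) : ℂ) := by
    have j1 : Integrable (fun ω => ((t * Z ω : ℝ) : ℂ) * Complex.I) P :=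
      ((i1.const_mul t).ofReal).mul_const _
    have j2 : Integrable (fun ω => (((t ^ 2 / 2) * Z ω ^ 2 : ℝ) : ℂ)) P :=
      (i2.const_mul (t ^ 2 / 2)).ofReal
    have e : ∀ ω, (1 + ((t * Z ω : ℝ) : ℂ) * Complex.I - ((t * Z ω : ℝ) : ℂ) ^ 2 / 2) =
        1 + ((t * Z ω : ℝ) : ℂ) * Complex.I - (((t ^ 2 / 2) * Z ω ^ 2 : ℝ) : ℂ) := by
      intro ω; push_cast; ring
    simp_rw [e]
    have j0 : Integrable (fun ω => 1 + ((t * Z ω : ℝ) : ℂ) * Complex.I) P :=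
      (integrable_const _).add j1
    rw [integral_sub j0 j2, integral_add (integrable_const _) j1, integral_mul_const,
      integral_complex_ofReal, integral_complex_ofReal, integral_const_mul, integral_const_mul, h0]
    simp
    ring
  have hc : charFun (P.map Z) t = ∫ ω, Complex.exp (((t * Z ω : ℝ) : ℂ) * Complex.I) ∂P := by
    rw [charFun_apply_real, integral_map hm (by fun_prop)]
    push_cast; rfl
  have hA : ‖charFun (P.map Z) t - ((1 - v * t ^ 2 / 2 : ℝ) : ℂ)‖ ≤
      4 * |t| ^ 3 * ∫ ω, |Z ω| ^ 3 ∂P := by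
    rw [hc, ← hq, ← integral_sub ie iq, ← integral_const_mul]
    refine norm_integral_le_of_norm_le (i3.const_mul _) (.of_forall fun ω => ?_)
    have := norm_cexp_mul_I_sub_taylor_le (t * Z ω)
    rw [abs_mul, mul_pow, ← mul_assoc] at this
    exact this
  have hB : ‖((1 - v * t ^ 2 / 2 : ℝ) : ℂ) - (Real.exp (-v * t ^ 2 / 2) : ℝ)‖ ≤
      v ^ 2 * t ^ 4 := by
    rw [← Complex.ofReal_sub, Complex.norm_real, Real.norm_eq_abs, abs_sub_comm]
    have := abs_exp_neg_sub_le (y := v * t ^ 2 / 2) (by positivity)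
    rw [show -v * t ^ 2 / 2 = -(v * t ^ 2 / 2) by ring]
    refine this.trans ?_
    have : 0 ≤ v ^ 2 * t ^ 4 := by positivity
    nlinarith
  exact (norm_sub_le_norm_sub_add_norm_sub _ _ _).trans (add_le_add hA hB)

/-- Third moments are easy to bound about the binomial mean, but the conditioned variable has
another mean; recentring costs a factor 8. With l = E|Z - c|, the shift is at most l, (a + l)³ ≤ 4a³
+ 4l³, and l³ ≤ E|Z - c|³ by Jensen. -/
lemma integral_abs_sub_integral_pow_three_le {Z : Ω → ℝ} (hZ : MemLp Z 3 P) (c : ℝ) :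
    ∫ ω, |Z ω - ∫ ω', Z ω' ∂P| ^ 3 ∂P ≤ 8 * ∫ ω, |Z ω - c| ^ 3 ∂P := by
  have hY : MemLp (fun ω => Z ω - c) 3 P := hZ.sub (memLp_const c)
  have i1 : Integrable (fun ω => |Z ω - c|) P := (hY.integrable (by norm_num)).abs
  have i3 : Integrable (fun ω => |Z ω - c| ^ 3) P := hY.integrable_norm_pow (by norm_num)
  have hZ' : MemLp (fun ω => Z ω - ∫ ω', Z ω' ∂P) 3 P := hZ.sub (memLp_const _)
  have i3' : Integrable (fun ω => |Z ω - ∫ ω', Z ω' ∂P| ^ 3) P :=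
    hZ'.integrable_norm_pow (by norm_num)
  set l := ∫ ω, |Z ω - c| ∂P with hl
  have hl0 : 0 ≤ l := integral_nonneg fun _ => abs_nonneg _
  have hlm : |c - ∫ ω', Z ω' ∂P| ≤ l := by
    rw [abs_sub_comm]
    have : ∫ ω', Z ω' ∂P - c = ∫ ω', (Z ω' - c) ∂P := by
      rw [integral_sub (hZ.integrable (by norm_num)) (integrable_const _)]; simp
    rw [this]
    exact abs_integral_le_integral_abs
  have hj : l ^ 3 ≤ ∫ ω, |Z ω - c| ^ 3 ∂P := by
    -- Jensen by hand: 3l²x - 2l³ is the tangent line to x³ at x = l.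
    have : ∫ ω, (3 * l ^ 2 * |Z ω - c| - 2 * l ^ 3) ∂P ≤ ∫ ω, |Z ω - c| ^ 3 ∂P := by
      refine integral_mono ((i1.const_mul _).sub (integrable_const _)) i3 fun ω => ?_
      nlinarith [mul_nonneg (sq_nonneg (|Z ω - c| - l))
        (add_nonneg (abs_nonneg (Z ω - c)) (mul_nonneg zero_le_two hl0))]
    rw [integral_sub (i1.const_mul _) (integrable_const _), integral_const_mul, ← hl] at this
    simp at this
    nlinarith
  have : ∫ ω, |Z ω - ∫ ω', Z ω' ∂P| ^ 3 ∂P ≤ ∫ ω, (4 * |Z ω - c| ^ 3 + 4 * l ^ 3) ∂P := by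
    refine integral_mono i3' ((i3.const_mul _).add (integrable_const _)) fun ω => ?_
    have h1 : |Z ω - ∫ ω', Z ω' ∂P| ≤ |Z ω - c| + l :=
      (abs_sub_le _ c _).trans (by gcongr)
    have h2 : |Z ω - ∫ ω', Z ω' ∂P| ^ 3 ≤ (|Z ω - c| + l) ^ 3 := by gcongr
    have ha := abs_nonneg (Z ω - c)
    nlinarith [mul_nonneg (add_nonneg ha hl0) (sq_nonneg (|Z ω - c| - l))]
  rw [integral_add (i3.const_mul _) (integrable_const _), integral_const_mul] at this
  simp at this
  linarith

end

/-! ### Decay and variance from a flat window -/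

/-- If D|t| ≤ π, pairing j with j + D extracts the factor |1 + z^D| = 2 cos(Dt/2) ≤ 2 - (Dt/π)².
Otherwise the closed form of the geometric series bounds the sum by 1/|sin(t/2)| ≤ π/|t| ≤ D. -/
lemma norm_geom_sum_cexp_le (D : ℕ) {t : ℝ} (ht : |t| ≤ Real.pi) :
    ‖∑ j ∈ Finset.range (2 * D), Complex.exp (t * Complex.I) ^ j‖ ≤
      2 * D - D * min 1 ((D * t / Real.pi) ^ 2) := by
  have hpi := Real.pi_pos
  set z := Complex.exp (t * Complex.I) with hz
  have hzn : ‖z‖ = 1 := Complex.norm_exp_ofReal_mul_I t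
  rcases le_total (D * |t|) Real.pi with h | h
  · have e : ∑ j ∈ Finset.range (2 * D), z ^ j = (∑ j ∈ Finset.range D, z ^ j) * (1 + z ^ D) := by
      rw [two_mul, Finset.sum_range_add, mul_add, mul_one, Finset.sum_mul]
      congr 1
      exact Finset.sum_congr rfl fun j _ => by rw [pow_add, mul_comm]
    have h1 : ‖∑ j ∈ Finset.range D, z ^ j‖ ≤ D := by
      refine (norm_sum_le _ _).trans ?_
      simp [hzn]
    have h2 : ‖1 + z ^ D‖ ≤ 2 - (D * t / Real.pi) ^ 2 := by
      have e2 : 1 + z ^ D = Complex.exp (((D * t / 2 : ℝ) : ℂ) * Complex.I) *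
          ((2 * Real.cos (D * t / 2) : ℝ) : ℂ) := by
        rw [Complex.ofReal_mul, Complex.ofReal_cos, Complex.ofReal_ofNat, Complex.two_cos, mul_add,
          ← Complex.exp_add, ← Complex.exp_add, hz, ← Complex.exp_nat_mul]
        rw [add_comm]
        congr 1
        · congr 1; push_cast; ring
        · rw [← add_mul]; simp
      have habs : |D * t / 2| ≤ Real.pi / 2 := by
        rw [abs_div, abs_mul, Nat.abs_cast, abs_two]; gcongr
      rw [e2, norm_mul, Complex.norm_exp_ofReal_mul_I, one_mul, Complex.norm_real,
        Real.norm_of_nonneg (mul_nonneg zero_le_two (Real.cos_nonneg_of_mem_Icc (abs_le.1 habs)))]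
      have h3 := Real.cos_le_one_sub_mul_cos_sq (x := D * t / 2) (by linarith)
      calc 2 * Real.cos (D * t / 2) ≤ 2 * (1 - 2 / Real.pi ^ 2 * (D * t / 2) ^ 2) := by gcongr
        _ = _ := by field_simp
    have h3 : min 1 ((D * t / Real.pi) ^ 2) ≤ (D * t / Real.pi) ^ 2 := min_le_right _ _
    rw [e, norm_mul]
    calc _ ≤ D * (2 - (D * t / Real.pi) ^ 2) := by gcongr
      _ ≤ D * (2 - min 1 ((D * t / Real.pi) ^ 2)) := by gcongr
      _ = _ := by ring
  · have h1 : (∑ j ∈ Finset.range (2 * D), z ^ j) * (z - 1) = z ^ (2 * D) - 1 := geom_sum_mul _ _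
    have h2 : ‖z ^ (2 * D) - 1‖ ≤ 2 := by
      refine (norm_sub_le _ _).trans ?_
      rw [norm_pow, hzn]; norm_num
    have h3 : ‖z - 1‖ = 2 * |Real.sin (t / 2)| := by
      rw [hz, mul_comm, Complex.norm_exp_I_mul_ofReal_sub_one]; simp
    have h4 : |t| / Real.pi ≤ |Real.sin (t / 2)| := by
      have e : |Real.sin (t / 2)| = Real.sin (|t| / 2) := by
        rcases abs_cases t with ⟨h, h'⟩ | ⟨h, h'⟩
        · rw [h, abs_of_nonneg (Real.sin_nonneg_of_nonneg_of_le_pi (by linarith) (by linarith))]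
        · rw [h, neg_div, Real.sin_neg, abs_of_nonpos]
          have := Real.sin_nonneg_of_nonneg_of_le_pi (x := -t / 2) (by linarith) (by linarith)
          rw [neg_div, Real.sin_neg] at this
          linarith
      rw [e]
      have := Real.mul_le_sin (x := |t| / 2) (by positivity) (by linarith)
      calc _ = 2 / Real.pi * (|t| / 2) := by ring
        _ ≤ _ := this
    have h5 : ‖∑ j ∈ Finset.range (2 * D), z ^ j‖ * (|t| / Real.pi) ≤ 1 := by
      have := congrArg norm h1
      rw [norm_mul, h3] at this
      nlinarith [norm_nonneg (∑ j ∈ Finset.range (2 * D), z ^ j)]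
    have h6 : 1 ≤ D * (|t| / Real.pi) := by
      rw [← mul_div_assoc, le_div_iff₀ hpi]; linarith
    have h7 : ‖∑ j ∈ Finset.range (2 * D), z ^ j‖ ≤ D := by
      by_contra hlt
      push Not at hlt
      have ht0 : 0 < |t| / Real.pi := by
        by_contra h0
        push Not at h0
        have : |t| / Real.pi = 0 := le_antisymm h0 (by positivity)
        rw [this] at h6; norm_num at h6
      nlinarith
    have h8 : min 1 ((D * t / Real.pi) ^ 2) ≤ 1 := min_le_left _ _
    have : (D : ℝ) * min 1 ((D * t / Real.pi) ^ 2) ≤ D * 1 := by gcongr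
    linarith

/-- The measure η times counting on the window is split off. The remainder has mass 1 - 2Dη and is
bounded trivially; only the uniform piece produces cancellation. -/
lemma norm_integral_cexp_nat_le (Q : Measure ℕ) [IsProbabilityMeasure Q] {a D : ℕ} {η : ℝ}
    (hη0 : 0 ≤ η) (hη : ∀ j < 2 * D, η ≤ Q.real {a + j})
    {t : ℝ} (ht : |t| ≤ Real.pi) :
    ‖∫ x : ℕ, Complex.exp (t * x * Complex.I) ∂Q‖ ≤
      1 - η * D * min 1 ((D * t / Real.pi) ^ 2) := by
  set f : ℕ → ℂ := fun x => Complex.exp (t * x * Complex.I) with hf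
  have hfn : ∀ x, ‖f x‖ = 1 := by
    intro x
    simp only [hf]
    rw [show (t * x * Complex.I : ℂ) = ((t * x : ℝ) : ℂ) * Complex.I by push_cast; ring,
      Complex.norm_exp_ofReal_mul_I]
  have hfi : Integrable f Q := (integrable_const (1 : ℝ)).mono'
    (measurable_of_countable _).aestronglyMeasurable (.of_forall fun x => (hfn x).le)
  set W : Finset ℕ := (Finset.range (2 * D)).map (addLeftEmbedding a) with hW
  have hWm : MeasurableSet (W : Set ℕ) := W.measurableSet
  have h1 : ∫ x in (W : Set ℕ)ᶜ, f x ∂Q + ∫ x in (W : Set ℕ), f x ∂Q = ∫ x, f x ∂Q := by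
    rw [add_comm]; exact integral_add_compl hWm hfi
  have h2 : ‖∫ x in (W : Set ℕ)ᶜ, f x ∂Q‖ ≤ 1 - ∑ x ∈ W, Q.real {x} := by
    have := norm_setIntegral_le_of_norm_le_const (μ := Q) (s := (W : Set ℕ)ᶜ) (f := f) (C := 1)
      (measure_lt_top _ _) (fun x _ => (hfn x).le)
    rw [one_mul, probReal_compl_eq_one_sub hWm] at this
    rw [sum_measureReal_singleton]
    exact this
  have h3 : ∫ x in (W : Set ℕ), f x ∂Q = ∑ x ∈ W, (Q.real {x} - η) • f x + η • ∑ x ∈ W, f x := by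
    rw [setIntegral_finset _ hfi.integrableOn, Finset.smul_sum, ← Finset.sum_add_distrib]
    exact Finset.sum_congr rfl fun x _ => by rw [← add_smul, sub_add_cancel]
  have h4 : ‖∑ x ∈ W, (Q.real {x} - η) • f x‖ ≤ ∑ x ∈ W, Q.real {x} - 2 * D * η := by
    refine (norm_sum_le _ _).trans ?_
    have : ∀ x ∈ W, ‖(Q.real {x} - η) • f x‖ = Q.real {x} - η := by
      intro x hx
      rw [hW, Finset.mem_map] at hx
      obtain ⟨j, hj, rfl⟩ := hx
      rw [norm_smul, hfn, mul_one, Real.norm_of_nonneg]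
      exact sub_nonneg.2 (hη j (Finset.mem_range.1 hj))
    rw [Finset.sum_congr rfl this, Finset.sum_sub_distrib]
    simp [hW]
  have h5 : ‖∑ x ∈ W, f x‖ ≤ 2 * D - D * min 1 ((D * t / Real.pi) ^ 2) := by
    have e : ∑ x ∈ W, f x = f a * ∑ j ∈ Finset.range (2 * D), Complex.exp (t * Complex.I) ^ j := by
      rw [hW, Finset.sum_map, Finset.mul_sum]
      refine Finset.sum_congr rfl fun j _ => ?_
      simp only [hf, addLeftEmbedding_apply]
      rw [← Complex.exp_nat_mul, ← Complex.exp_add]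
      congr 1
      push_cast
      ring
    rw [e, norm_mul, hfn, one_mul]
    exact norm_geom_sum_cexp_le D ht
  rw [← h1, h3]
  have h6 : ‖η • ∑ x ∈ W, f x‖ ≤ η * (2 * D - D * min 1 ((D * t / Real.pi) ^ 2)) := by
    rw [norm_smul, Real.norm_of_nonneg hη0]; gcongr
  calc _ ≤ (1 - ∑ x ∈ W, Q.real {x}) + ((∑ x ∈ W, Q.real {x} - 2 * D * η) +
        η * (2 * D - D * min 1 ((D * t / Real.pi) ^ 2))) :=
        (norm_add_le _ _).trans (add_le_add h2 ((norm_add_le _ _).trans (add_le_add h4 h6)))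
    _ = _ := by ring

/-- Points at distance D satisfy (x - c)² + (x + D - c)² ≥ D²/2, whatever c is; the window consists
of D such pairs. -/
lemma le_integral_sub_sq_nat (Q : Measure ℕ) {a D : ℕ} {η : ℝ} (hη0 : 0 ≤ η)
    (hη : ∀ j < 2 * D, η ≤ Q.real {a + j}) (c : ℝ)
    (hi : Integrable (fun x : ℕ => ((x : ℝ) - c) ^ 2) Q) :
    η * D ^ 3 / 2 ≤ ∫ x : ℕ, ((x : ℝ) - c) ^ 2 ∂Q := by
  set W : Finset ℕ := (Finset.range (2 * D)).map (addLeftEmbedding a) with hW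
  have h1 : ∫ x in (W : Set ℕ), ((x : ℝ) - c) ^ 2 ∂Q ≤ ∫ x : ℕ, ((x : ℝ) - c) ^ 2 ∂Q :=
    setIntegral_le_integral hi (.of_forall fun x => sq_nonneg _)
  refine le_trans ?_ h1
  rw [setIntegral_finset _ hi.integrableOn, hW, Finset.sum_map]
  calc η * D ^ 3 / 2 = ∑ j ∈ Finset.range D, η * (D ^ 2 / 2 : ℝ) := by simp; ring
    _ ≤ ∑ j ∈ Finset.range D, η * ((((a + j : ℕ) : ℝ) - c) ^ 2 +
          (((a + (D + j) : ℕ) : ℝ) - c) ^ 2) := by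
        gcongr with j _
        push_cast
        nlinarith [sq_nonneg (((a : ℝ) + j - c) + ((a : ℝ) + (D + j) - c))]
    _ = ∑ j ∈ Finset.range (2 * D), η * (((a + j : ℕ) : ℝ) - c) ^ 2 := by
        rw [two_mul, Finset.sum_range_add, ← Finset.sum_add_distrib]
        simp_rw [mul_add]
    _ ≤ _ := by
        refine Finset.sum_le_sum fun j hj => ?_
        rw [smul_eq_mul]
        exact mul_le_mul_of_nonneg_right (hη j (Finset.mem_range.1 hj)) (sq_nonneg _)

/-! ### Moments of the binomial and mass on each side of its mean -/

lemma integral_binomial_succ (N : ℕ) (q : unitInterval) (f : ℕ → ℝ) :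
    ∫ x, f x ∂(binomial (N + 1) q) =
      q * ∫ x, f (x + 1) ∂(binomial N q) + (1 - q) * ∫ x, f x ∂(binomial N q) := by
  have h : ∀ (M : ℕ) (g : ℕ → ℝ), ∫ x, g x ∂(binomial M q) =
      ∑ ij ∈ Finset.HasAntidiagonal.antidiagonal M,
        (M.choose ij.1 : ℝ) * (((q : ℝ) ^ ij.1 * (1 - q) ^ ij.2) * g ij.1) := by
    intro M g
    rw [integral_binomial, Finset.Nat.sum_antidiagonal_eq_sum_range_succ_mk,
      ← Nat.range_succ_eq_Iic]
    simp only [smul_eq_mul]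
    exact Finset.sum_congr rfl fun _ _ => by ring
  rw [h, h, h, Finset.sum_antidiagonal_choose_succ_mul
    (fun i j => ((q : ℝ) ^ i * (1 - q) ^ j) * f i), Finset.mul_sum, Finset.mul_sum, add_comm]
  congr 1
  · exact Finset.sum_congr rfl fun ij hij => by
      rw [Finset.HasAntidiagonal.mem_antidiagonal] at hij
      rw [← hij, Nat.choose_symm_add, pow_succ]; ring
  · exact Finset.sum_congr rfl fun _ _ => by rw [pow_succ]; ring

/-- The first, second and fourth central moments of the binomial distribution. -/
lemma binomial_central_moments (N : ℕ) (q : unitInterval) :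
    ∫ x : ℕ, ((x : ℝ) - N * q) ∂(binomial N q) = 0 ∧
    ∫ x : ℕ, ((x : ℝ) - N * q) ^ 2 ∂(binomial N q) = N * q * (1 - q) ∧
    ∫ x : ℕ, ((x : ℝ) - N * q) ^ 4 ∂(binomial N q) =
      3 * N * (N - 1) * (q * (1 - q)) ^ 2 + N * q * (1 - q) * (1 - 3 * q * (1 - q)) := by
  induction N with
  | zero => simp [binomial_zero]
  | succ N ih =>
    obtain ⟨h1, h2, h4⟩ := ih
    -- The third moment needs no formula: in the recursion for the fourth it appears with
    -- coefficient q · 4(1 - q) - (1 - q) · 4q = 0.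
    set m3 := ∫ x : ℕ, ((x : ℝ) - N * q) ^ 3 ∂(binomial N q) with h3
    have hlin : ∀ c0 c1 c2 c3 c4 : ℝ, ∫ x : ℕ, (c0 + c1 * ((x : ℝ) - N * q)
        + c2 * ((x : ℝ) - N * q) ^ 2 + c3 * ((x : ℝ) - N * q) ^ 3
        + c4 * ((x : ℝ) - N * q) ^ 4) ∂(binomial N q) =
        c0 + c2 * (N * q * (1 - q)) + c3 * m3 +
        c4 * ∫ x : ℕ, ((x : ℝ) - N * q) ^ 4 ∂(binomial N q) := by
      intro c0 c1 c2 c3 c4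
      rw [integral_add (integrable_binomial _) (integrable_binomial _),
        integral_add (integrable_binomial _) (integrable_binomial _),
        integral_add (integrable_binomial _) (integrable_binomial _),
        integral_add (integrable_binomial _) (integrable_binomial _)]
      simp only [integral_const_mul]
      rw [h1, h2, ← h3]
      simp
    refine ⟨?_, ?_, ?_⟩
    · rw [integral_binomial_succ]
      have e1 : ∀ x : ℕ, (((x + 1 : ℕ) : ℝ) - ((N + 1 : ℕ) : ℝ) * q) = (1 - q) + 1 * ((x : ℝ) - N * q)
        + 0 * ((x : ℝ) - N * q) ^ 2 + 0 * ((x : ℝ) - N * q) ^ 3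
        + 0 * ((x : ℝ) - N * q) ^ 4 := by intro x; push_cast; ring
      have e2 : ∀ x : ℕ, ((x : ℝ) - ((N + 1 : ℕ) : ℝ) * q) = (-q) + 1 * ((x : ℝ) - N * q)
        + 0 * ((x : ℝ) - N * q) ^ 2 + 0 * ((x : ℝ) - N * q) ^ 3
        + 0 * ((x : ℝ) - N * q) ^ 4 := by intro x; push_cast; ring
      simp_rw [e1, e2]
      rw [hlin, hlin]
      ring
    · rw [integral_binomial_succ]
      have e1 : ∀ x : ℕ, (((x + 1 : ℕ) : ℝ) - ((N + 1 : ℕ) : ℝ) * q) ^ 2 = (1 - (q : ℝ)) ^ 2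
        + 2 * (1 - q) * ((x : ℝ) - N * q)
        + 1 * ((x : ℝ) - N * q) ^ 2 + 0 * ((x : ℝ) - N * q) ^ 3
        + 0 * ((x : ℝ) - N * q) ^ 4 := by intro x; push_cast; ring
      have e2 : ∀ x : ℕ, ((x : ℝ) - ((N + 1 : ℕ) : ℝ) * q) ^ 2 = (q : ℝ) ^ 2
        + (-2 * q) * ((x : ℝ) - N * q)
        + 1 * ((x : ℝ) - N * q) ^ 2 + 0 * ((x : ℝ) - N * q) ^ 3
        + 0 * ((x : ℝ) - N * q) ^ 4 := by intro x; push_cast; ring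
      simp_rw [e1, e2]
      rw [hlin, hlin]
      push_cast
      ring
    · rw [integral_binomial_succ]
      have e1 : ∀ x : ℕ, (((x + 1 : ℕ) : ℝ) - ((N + 1 : ℕ) : ℝ) * q) ^ 4 = (1 - (q : ℝ)) ^ 4
        + 4 * (1 - (q : ℝ)) ^ 3 * ((x : ℝ) - N * q)
        + 6 * (1 - (q : ℝ)) ^ 2 * ((x : ℝ) - N * q) ^ 2
        + 4 * (1 - (q : ℝ)) * ((x : ℝ) - N * q) ^ 3
        + 1 * ((x : ℝ) - N * q) ^ 4 := by intro x; push_cast; ring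
      have e2 : ∀ x : ℕ, ((x : ℝ) - ((N + 1 : ℕ) : ℝ) * q) ^ 4 = (q : ℝ) ^ 4
        + (-4 * (q : ℝ) ^ 3) * ((x : ℝ) - N * q)
        + 6 * (q : ℝ) ^ 2 * ((x : ℝ) - N * q) ^ 2
        + (-4 * (q : ℝ)) * ((x : ℝ) - N * q) ^ 3
        + 1 * ((x : ℝ) - N * q) ^ 4 := by intro x; push_cast; ring
      simp_rw [e1, e2]
      rw [hlin, hlin, h4]
      push_cast
      ring

lemma integral_binomial_sub_pow_four_le (N : ℕ) (q : unitInterval)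
    (h : 1 ≤ N * (q : ℝ) * (1 - q)) :
    ∫ x : ℕ, ((x : ℝ) - N * q) ^ 4 ∂(binomial N q) ≤ 4 * (N * q * (1 - q)) ^ 2 := by
  rw [(binomial_central_moments N q).2.2]
  have h0 := q.2.1
  have h1 := q.2.2
  have hq : 0 ≤ (q : ℝ) * (1 - q) := mul_nonneg h0 (by linarith)
  have hN : (0 : ℝ) ≤ N := N.cast_nonneg
  have := mul_nonneg hN (mul_nonneg hq hq)
  nlinarith

/-- A Paley–Zygmund type bound: a centred variable with controlled fourth moment lies to the right
of its mean, at distance comparable with its standard deviation, with probability at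
least `1 / 20`. -/
lemma le_measureReal_setOf_mem_Icc {Ω : Type*} [MeasurableSpace Ω] {P : Measure Ω}
    [IsProbabilityMeasure P] {Z : Ω → ℝ} (hZm : Measurable Z) {w : ℝ} (hw : 0 < w)
    (i1 : Integrable Z P) (i2 : Integrable (fun x => Z x ^ 2) P)
    (i4 : Integrable (fun x => Z x ^ 4) P)
    (h1 : ∫ x, Z x ∂P = 0) (h2 : ∫ x, Z x ^ 2 ∂P = w ^ 2) (h4 : ∫ x, Z x ^ 4 ∂P ≤ 4 * (w ^ 2) ^ 2) :
    1 / 20 ≤ P.real {x | w / 8 ≤ Z x ∧ Z x ≤ 3 * w} := by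
  -- A quartic minorant of 20 times the indicator of [1/8, 3]. At u = Z/w the moments are 0, 1 and
  -- at most 4, so its expectation is at least 6 - 4 - 17/20 ≥ 1.
  have key : ∀ u : ℝ, 6 * u + 6 * u ^ 2 - u ^ 4 - 17 / 20 ≤
      20 * Set.indicator (Set.Icc (1 / 8) 3) (fun _ => (1 : ℝ)) u := by
    intro u
    by_cases h : u ∈ Set.Icc (1 / 8 : ℝ) 3
    · rw [Set.indicator_of_mem h]
      nlinarith [sq_nonneg (u ^ 2 - 19 / 5), sq_nonneg (u - 15 / 8)]
    · rw [Set.indicator_of_notMem h, mul_zero]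
      rw [Set.mem_Icc, not_and_or, not_le, not_le] at h
      rcases h with h | h
      · rcases le_total 0 u with h0 | h0
        · nlinarith [pow_nonneg h0 4]
        -- With v = -u, the cubic factor of v⁴ - 6v² + 6v is minimal at √2 ≈ 71/50, where it is
        -- still positive; the product below is a rational certificate of this.
        · have h5 : 0 ≤ (-u) * ((-u - 71 / 50) ^ 2 * (-u + 71 / 25)) :=
            mul_nonneg (by linarith) (mul_nonneg (sq_nonneg _) (by linarith))
          nlinarith
      · nlinarith [mul_nonneg (sq_nonneg u) (show 0 ≤ u ^ 2 - 9 by nlinarith)]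
  have hm : MeasurableSet {x | w / 8 ≤ Z x ∧ Z x ≤ 3 * w} :=
    (measurableSet_le measurable_const hZm).inter (measurableSet_le hZm measurable_const)
  have h5 : ∫ x, (6 / w * Z x + 6 / w ^ 2 * Z x ^ 2 - 1 / w ^ 4 * Z x ^ 4 - 17 / 20) ∂P ≤
      ∫ x, 20 * Set.indicator {x | w / 8 ≤ Z x ∧ Z x ≤ 3 * w} (fun _ => (1 : ℝ)) x ∂P := by
    refine integral_mono ((((i1.const_mul _).add (i2.const_mul _)).sub (i4.const_mul _)).sub
      (integrable_const _)) (((integrable_const (1 : ℝ)).indicator hm).const_mul _) fun x => ?_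
    have := key (Z x / w)
    have e : Set.indicator (Set.Icc (1 / 8) 3) (fun _ => (1 : ℝ)) (Z x / w) =
        Set.indicator {x | w / 8 ≤ Z x ∧ Z x ≤ 3 * w} (fun _ => (1 : ℝ)) x := by
      have : Z x / w ∈ Set.Icc (1 / 8 : ℝ) 3 ↔ x ∈ {x | w / 8 ≤ Z x ∧ Z x ≤ 3 * w} := by
        rw [Set.mem_Icc, Set.mem_ofPred_eq, le_div_iff₀ hw, div_le_iff₀ hw, one_div_mul_eq_div]
      simp only [Set.indicator_apply, this]
    rw [e] at this
    refine le_trans (le_of_eq ?_) this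
    field_simp
  have ia : Integrable (fun x => 6 / w * Z x) P := i1.const_mul _
  have ib : Integrable (fun x => 6 / w ^ 2 * Z x ^ 2) P := i2.const_mul _
  have ic : Integrable (fun x => 1 / w ^ 4 * Z x ^ 4) P := i4.const_mul _
  have iab : Integrable (fun x => 6 / w * Z x + 6 / w ^ 2 * Z x ^ 2) P := ia.add ib
  have iabc : Integrable (fun x => 6 / w * Z x + 6 / w ^ 2 * Z x ^ 2 - 1 / w ^ 4 * Z x ^ 4) P :=
    iab.sub ic
  rw [integral_sub iabc (integrable_const _), integral_sub iab ic, integral_add ia ib,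
    integral_const_mul, integral_const_mul, integral_const_mul, integral_const_mul, h1, h2,
    integral_indicator_const _ hm] at h5
  simp only [smul_eq_mul, mul_one, integral_const, probReal_univ, mul_zero, one_mul] at h5
  have h6 : 1 / w ^ 4 * ∫ x, Z x ^ 4 ∂P ≤ 4 := by
    rw [one_div_mul_eq_div, div_le_iff₀ (by positivity)]
    calc _ ≤ _ := h4
      _ = _ := by ring
  have h7 : 6 / w ^ 2 * w ^ 2 = 6 := by field_simp
  linarith

lemma le_binomial_right_of_mean (N : ℕ) (q : unitInterval) {w : ℝ} (hw : 1 ≤ w)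
    (hv : N * (q : ℝ) * (1 - q) = w ^ 2) :
    1 / 20 ≤ (binomial N q).real {x : ℕ | N * (q : ℝ) + w / 8 ≤ (x : ℝ) ∧ (x : ℝ) ≤ N * q + 3 * w} := by
  obtain ⟨h1, h2, -⟩ := binomial_central_moments N q
  have h4 := integral_binomial_sub_pow_four_le N q (by rw [hv]; exact one_le_pow₀ hw)
  rw [hv] at h2 h4
  refine (le_measureReal_setOf_mem_Icc (P := binomial N q) (Z := fun x : ℕ => (x : ℝ) - N * q)
    (measurable_of_countable _) (by linarith) (integrable_binomial _) (integrable_binomial _)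
    (integrable_binomial _) h1 h2 h4).trans (le_of_eq ?_)
  congr 1
  ext x
  simp only [Set.mem_ofPred_eq]
  constructor <;> rintro ⟨h, h'⟩ <;> constructor <;> linarith

lemma le_binomial_left_of_mean (N : ℕ) (q : unitInterval) {w : ℝ} (hw : 1 ≤ w)
    (hv : N * (q : ℝ) * (1 - q) = w ^ 2) :
    1 / 20 ≤ (binomial N q).real {x : ℕ | N * (q : ℝ) - 3 * w ≤ (x : ℝ) ∧ (x : ℝ) ≤ N * q - w / 8} := by
  obtain ⟨h1, h2, -⟩ := binomial_central_moments N q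
  have h4 := integral_binomial_sub_pow_four_le N q (by rw [hv]; exact one_le_pow₀ hw)
  rw [hv] at h2 h4
  refine (le_measureReal_setOf_mem_Icc (P := binomial N q) (Z := fun x : ℕ => -((x : ℝ) - N * q))
    (w := w) (measurable_of_countable _) (by linarith) (integrable_binomial _)
    (integrable_binomial _) (integrable_binomial _) ?_ ?_ ?_).trans (le_of_eq ?_)
  · rw [integral_neg, h1, neg_zero]
  · simp_rw [neg_sq]; exact h2
  · simp_rw [Even.neg_pow (show Even 4 by decide)]; exact h4
  · congr 1
    ext x
    simp only [Set.mem_ofPred_eq]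
    constructor <;> rintro ⟨h, h'⟩ <;> constructor <;> linarith

/-- AM–GM gives |z|³ ≤ (w/2) z² + z⁴/(2w), whence w³/2 + 2w³. -/
lemma integral_binomial_abs_sub_pow_three_le (N : ℕ) (q : unitInterval) {w : ℝ} (hw : 1 ≤ w)
    (hv : N * (q : ℝ) * (1 - q) = w ^ 2) :
    ∫ x : ℕ, |(x : ℝ) - N * q| ^ 3 ∂(binomial N q) ≤ 5 / 2 * w ^ 3 := by
  obtain ⟨-, h2, -⟩ := binomial_central_moments N q
  have h4 := integral_binomial_sub_pow_four_le N q (by rw [hv]; exact one_le_pow₀ hw)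
  rw [hv] at h2 h4
  have hw0 : 0 < w := by linarith
  have : ∫ x : ℕ, |(x : ℝ) - N * q| ^ 3 ∂(binomial N q) ≤
      ∫ x : ℕ, (w / 2 * ((x : ℝ) - N * q) ^ 2 + 1 / (2 * w) * ((x : ℝ) - N * q) ^ 4)
        ∂(binomial N q) := by
    refine integral_mono (integrable_binomial _) (integrable_binomial _) fun x => ?_
    simp only
    set z := |(x : ℝ) - N * q| with hz
    have e2 : ((x : ℝ) - N * q) ^ 2 = z ^ 2 := (sq_abs _).symm
    have e4 : ((x : ℝ) - N * q) ^ 4 = z ^ 4 := by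
      rw [show (4 : ℕ) = 2 * 2 by rfl, pow_mul, pow_mul, e2]
    rw [e2, e4]
    have : z ^ 3 = w / 2 * z ^ 2 + 1 / (2 * w) * z ^ 4 - (w * z - z ^ 2) ^ 2 / (2 * w) := by
      field_simp; ring
    rw [this]
    have : 0 ≤ (w * z - z ^ 2) ^ 2 / (2 * w) := by positivity
    linarith
  rw [integral_add (integrable_binomial _) (integrable_binomial _), integral_const_mul,
    integral_const_mul, h2] at this
  have h5 : 1 / (2 * w) * ∫ x : ℕ, ((x : ℝ) - N * q) ^ 4 ∂(binomial N q) ≤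
      1 / (2 * w) * (4 * (w ^ 2) ^ 2) := by gcongr
  have h6 : 1 / (2 * w) * (4 * (w ^ 2) ^ 2) = 2 * w ^ 3 := by field_simp; norm_num
  nlinarith

/-! ### Unimodality of the binomial and pigeonhole -/

/-- The ratio of consecutive masses, cross-multiplied so that it also holds for k ≥ N, where both
sides vanish. -/
lemma binomial_real_succ_mul (N k : ℕ) (q : unitInterval) :
    (binomial N q).real {k + 1} * ((k + 1) * (1 - q)) =
      (binomial N q).real {k} * ((N - k) * q) := by
  rw [binomial_real_singleton, binomial_real_singleton]
  rcases lt_or_ge k N with h | h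
  · have h1 : (N.choose (k + 1) : ℝ) * (k + 1) = N.choose k * (N - k) := by
      have := Nat.choose_succ_right_eq N k
      rw [← Nat.cast_sub h.le]
      exact_mod_cast this
    have h2 : (1 - (q : ℝ)) ^ (N - k) = (1 - q) ^ (N - (k + 1)) * (1 - q) := by
      rw [← pow_succ]; congr 1; omega
    rw [h2]
    calc _ = ((N.choose (k + 1) : ℝ) * (k + 1)) * (q ^ (k + 1) * (1 - q) ^ (N - (k + 1)) * (1 - q))
          := by ring
      _ = _ := by rw [h1]; ring
  · rw [Nat.choose_eq_zero_of_lt (by omega : N < k + 1)]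
    rcases h.eq_or_lt with rfl | h
    · simp
    · rw [Nat.choose_eq_zero_of_lt h]; simp

lemma binomial_real_le_succ {N k : ℕ} {q : unitInterval} (hq : (q : ℝ) < 1)
    (hk : (k : ℝ) + 1 ≤ N * q) : (binomial N q).real {k} ≤ (binomial N q).real {k + 1} := by
  have h := binomial_real_succ_mul N k q
  have hpos : 0 < ((k : ℝ) + 1) * (1 - q) := mul_pos (by positivity) (by linarith)
  refine le_of_mul_le_mul_right ?_ hpos
  rw [h]
  refine mul_le_mul_of_nonneg_left ?_ measureReal_nonneg
  nlinarith [q.2.1]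

lemma binomial_real_succ_le {N k : ℕ} {q : unitInterval} (hq : (q : ℝ) < 1)
    (hk : N * (q : ℝ) ≤ k) : (binomial N q).real {k + 1} ≤ (binomial N q).real {k} := by
  have h := binomial_real_succ_mul N k q
  have hpos : 0 < ((k : ℝ) + 1) * (1 - q) := mul_pos (by positivity) (by linarith)
  refine le_of_mul_le_mul_right ?_ hpos
  rw [h]
  refine mul_le_mul_of_nonneg_left ?_ measureReal_nonneg
  nlinarith [q.2.1]

lemma binomial_real_le_add {N a : ℕ} {q : unitInterval} (hq : (q : ℝ) < 1) (j : ℕ)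
    (hj : (a : ℝ) + j ≤ N * q) : (binomial N q).real {a} ≤ (binomial N q).real {a + j} := by
  induction j with
  | zero => simp
  | succ j ih =>
    push_cast at hj
    refine (ih (by linarith)).trans ?_
    rw [← add_assoc]
    exact binomial_real_le_succ hq (by push_cast; linarith)

lemma binomial_real_add_le {N a : ℕ} {q : unitInterval} (hq : (q : ℝ) < 1) (j : ℕ)
    (ha : N * (q : ℝ) ≤ a) : (binomial N q).real {a + j} ≤ (binomial N q).real {a} := by
  induction j with
  | zero => simp
  | succ j ih =>
    refine le_trans ?_ ih
    rw [← add_assoc]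
    refine binomial_real_succ_le hq ?_
    push_cast
    have : (0 : ℝ) ≤ j := j.cast_nonneg
    linarith

/-- Pigeonhole: the interval contains at most hi - lo + 1 integers. -/
lemma exists_le_measureReal_singleton (Q : Measure ℕ) [IsProbabilityMeasure Q] {lo hi c : ℝ}
    (hc : 0 < c) (hQ : c ≤ Q.real {x : ℕ | lo ≤ (x : ℝ) ∧ (x : ℝ) ≤ hi}) :
    ∃ a : ℕ, lo ≤ a ∧ a ≤ hi ∧ c / (hi - lo + 1) ≤ Q.real {a} := by
  have hne : ({x : ℕ | lo ≤ (x : ℝ) ∧ (x : ℝ) ≤ hi}).Nonempty := by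
    rw [Set.nonempty_iff_ne_empty]
    intro h
    rw [h] at hQ
    simp at hQ
    linarith
  obtain ⟨x0, hx0, hx0'⟩ := hne
  have hhi : 0 ≤ hi := (Nat.cast_nonneg x0).trans hx0'
  have hset : {x : ℕ | lo ≤ (x : ℝ) ∧ (x : ℝ) ≤ hi} =
      ((Finset.Icc ⌈lo⌉₊ ⌊hi⌋₊ : Finset ℕ) : Set ℕ) := by
    ext x
    simp [Nat.le_floor_iff hhi]
  have hle : ⌈lo⌉₊ ≤ ⌊hi⌋₊ := (Nat.ceil_le.2 hx0).trans (Nat.le_floor hx0')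
  have hcard : ((Finset.Icc ⌈lo⌉₊ ⌊hi⌋₊).card : ℝ) ≤ hi - lo + 1 := by
    rw [Nat.card_Icc, Nat.cast_sub (by omega)]
    have := Nat.floor_le hhi
    have := Nat.le_ceil lo
    push_cast
    linarith
  rw [hset, ← sum_measureReal_singleton] at hQ
  by_contra hcon
  push Not at hcon
  have hpos : 0 < hi - lo + 1 := by linarith
  have : ∑ x ∈ Finset.Icc ⌈lo⌉₊ ⌊hi⌋₊, Q.real {x} <
      ∑ x ∈ Finset.Icc ⌈lo⌉₊ ⌊hi⌋₊, c / (hi - lo + 1) := by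
    refine Finset.sum_lt_sum_of_nonempty (Finset.nonempty_Icc.2 hle) fun x hx => ?_
    rw [Finset.mem_Icc] at hx
    exact hcon x (Nat.ceil_le.1 hx.1) ((Nat.le_floor_iff hhi).1 hx.2)
  rw [Finset.sum_const, nsmul_eq_mul] at this
  have : ((Finset.Icc ⌈lo⌉₊ ⌊hi⌋₊).card : ℝ) * (c / (hi - lo + 1)) ≤
      (hi - lo + 1) * (c / (hi - lo + 1)) := by gcongr
  rw [mul_div_cancel₀ _ hpos.ne'] at this
  linarith

/-! ### Conditioning a product measure -/

section

variable {b b' : Measure ℕ} [IsProbabilityMeasure b']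

/-- Conditioning divides by a probability, hence only increases the mass of outcomes inside s. -/
lemma mul_le_cond_map_fst_real [IsProbabilityMeasure b] (s : Set (ℕ × ℕ)) (a : ℕ) :
    b.real {a} * b'.real {y | (a, y) ∈ s} ≤ ((cond (b.prod b') s).map Prod.fst).real {a} := by
  have hs : MeasurableSet s := s.to_countable.measurableSet
  rw [map_measureReal_apply measurable_fst (measurableSet_singleton a)]
  have h1 := congrArg ENNReal.toReal (cond_mul_eq_inter hs (Prod.fst ⁻¹' {a}) (b.prod b'))
  rw [ENNReal.toReal_mul] at h1
  have h2 : s ∩ Prod.fst ⁻¹' {a} = {a} ×ˢ {y | (a, y) ∈ s} := by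
    ext ⟨x, y⟩
    simp only [Set.mem_inter_iff, Set.mem_preimage, Set.mem_singleton_iff, Set.mem_prod,
      Set.mem_ofPred_eq]
    constructor
    · rintro ⟨h, rfl⟩; exact ⟨rfl, h⟩
    · rintro ⟨rfl, h⟩; exact ⟨h, rfl⟩
  rw [h2, ← measureReal_def, ← measureReal_def, ← measureReal_def, measureReal_prod_prod] at h1
  rw [← h1]
  exact mul_le_of_le_one_right measureReal_nonneg measureReal_le_one

lemma integrable_cond_map_fst (s : Set (ℕ × ℕ)) {f : ℕ → ℝ} (hf : Integrable f b) :
    Integrable f ((cond (b.prod b') s).map Prod.fst) := by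
  rw [integrable_map_measure (measurable_of_countable _).aestronglyMeasurable
    measurable_fst.aemeasurable]
  have h1 : Integrable (f ∘ Prod.fst) (b.prod b') := hf.comp_fst b'
  by_cases h0 : (b.prod b') s = 0
  · rw [cond_eq_zero_of_meas_eq_zero h0]
    exact integrable_zero_measure
  · rw [ProbabilityTheory.cond]
    exact h1.restrict.smul_measure (ENNReal.inv_ne_top.2 h0)

/-- The conditioned marginal has density at most 1/c with respect to b. -/
lemma integral_cond_map_fst_le (s : Set (ℕ × ℕ)) {f : ℕ → ℝ} (hf : Integrable f b)
    (h0 : ∀ x, 0 ≤ f x) {c : ℝ} (hc : 0 < c) (hs : c ≤ (b.prod b').real s) :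
    ∫ x, f x ∂((cond (b.prod b') s).map Prod.fst) ≤ c⁻¹ * ∫ x, f x ∂b := by
  have h1 : Integrable (f ∘ Prod.fst) (b.prod b') := hf.comp_fst b'
  rw [integral_map measurable_fst.aemeasurable (measurable_of_countable _).aestronglyMeasurable,
    ProbabilityTheory.cond, integral_smul_measure, ENNReal.toReal_inv, ← measureReal_def, smul_eq_mul]
  have h2 : ∫ z in s, f z.1 ∂(b.prod b') ≤ ∫ z, f z.1 ∂(b.prod b') :=
    setIntegral_le_integral h1 (.of_forall fun z => h0 _)
  have h3 : ∫ z, f z.1 ∂(b.prod b') = ∫ x, f x ∂b := by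
    rw [integral_fun_fst]; simp
  rw [h3] at h2
  have h4 : 0 ≤ ∫ z in s, f z.1 ∂(b.prod b') := integral_nonneg fun z => h0 _
  gcongr

lemma mul_le_prod_real [IsProbabilityMeasure b] {s : Set (ℕ × ℕ)} {A B : Set ℕ} (h : A ×ˢ B ⊆ s) :
    b.real A * b'.real B ≤ (b.prod b').real s := by
  rw [← measureReal_prod_prod]
  exact measureReal_mono h

end

/-! ### Binomials conditioned on their order -/

section

variable {N N' : ℕ} {q q' : unitInterval} {w w' : ℝ}

lemma le_prod_binomial_le (hw : 1 ≤ w) (hw' : 1 ≤ w') (hv : N * (q : ℝ) * (1 - q) = w ^ 2)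
    (hv' : N' * (q' : ℝ) * (1 - q') = w' ^ 2) (hd : |N * (q : ℝ) - N' * q'| ≤ w' / 8) :
    1 / 400 ≤ ((binomial N q).prod (binomial N' q')).real {z : ℕ × ℕ | z.1 ≤ z.2} := by
  rw [abs_le] at hd
  refine le_trans ?_ (mul_le_prod_real (A := {x : ℕ | N * (q : ℝ) - 3 * w ≤ (x : ℝ) ∧
      (x : ℝ) ≤ N * q - w / 8})
    (B := {x : ℕ | N' * (q' : ℝ) + w' / 8 ≤ (x : ℝ) ∧ (x : ℝ) ≤ N' * q' + 3 * w'}) ?_)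
  · have h1 := le_binomial_left_of_mean N q hw hv
    have h2 := le_binomial_right_of_mean N' q' hw' hv'
    calc (1 / 400 : ℝ) = 1 / 20 * (1 / 20) := by norm_num
      _ ≤ _ := mul_le_mul h1 h2 (by norm_num) measureReal_nonneg
  · rintro ⟨x, y⟩ ⟨⟨-, h1⟩, ⟨h2, -⟩⟩
    have : (x : ℝ) ≤ y := by
      simp only at h1 h2
      linarith
    exact_mod_cast this

lemma le_prod_binomial_gt (hw : 1 ≤ w) (hw' : 1 ≤ w') (hv : N * (q : ℝ) * (1 - q) = w ^ 2)
    (hv' : N' * (q' : ℝ) * (1 - q') = w' ^ 2) (hd : |N * (q : ℝ) - N' * q'| ≤ w' / 8) :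
    1 / 400 ≤ ((binomial N q).prod (binomial N' q')).real {z : ℕ × ℕ | z.1 > z.2} := by
  rw [abs_le] at hd
  refine le_trans ?_ (mul_le_prod_real (A := {x : ℕ | N * (q : ℝ) + w / 8 ≤ (x : ℝ) ∧
      (x : ℝ) ≤ N * q + 3 * w})
    (B := {x : ℕ | N' * (q' : ℝ) - 3 * w' ≤ (x : ℝ) ∧ (x : ℝ) ≤ N' * q' - w' / 8}) ?_)
  · have h1 := le_binomial_right_of_mean N q hw hv
    have h2 := le_binomial_left_of_mean N' q' hw' hv'
    calc (1 / 400 : ℝ) = 1 / 20 * (1 / 20) := by norm_num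
      _ ≤ _ := mul_le_mul h1 h2 (by norm_num) measureReal_nonneg
  · rintro ⟨x, y⟩ ⟨⟨h1, -⟩, ⟨-, h2⟩⟩
    have : (y : ℝ) < x := by
      simp only at h1 h2
      linarith
    exact_mod_cast this

lemma integral_abs_sub_pow_three_cond_map_fst_le (hw : 1 ≤ w)
    (hv : N * (q : ℝ) * (1 - q) = w ^ 2) {b' : Measure ℕ} [IsProbabilityMeasure b']
    {s : Set (ℕ × ℕ)} (hs : 1 / 400 ≤ ((binomial N q).prod b').real s) :
    ∫ x : ℕ, |(x : ℝ) - N * q| ^ 3 ∂((cond ((binomial N q).prod b') s).map Prod.fst) ≤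
      1000 * w ^ 3 := by
  have h1 := integral_cond_map_fst_le (b := binomial N q) (b' := b') s
    (integrable_binomial (fun x : ℕ => |(x : ℝ) - N * q| ^ 3))
    (fun x => by positivity) (by norm_num) hs
  have h2 := integral_binomial_abs_sub_pow_three_le N q hw hv
  linarith

lemma integral_sub_sq_cond_map_fst_le (hv : N * (q : ℝ) * (1 - q) = w ^ 2) {b' : Measure ℕ}
    [IsProbabilityMeasure b'] {s : Set (ℕ × ℕ)}
    (hs : 1 / 400 ≤ ((binomial N q).prod b').real s) :
    ∫ x : ℕ, ((x : ℝ) - N * q) ^ 2 ∂((cond ((binomial N q).prod b') s).map Prod.fst) ≤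
      400 * w ^ 2 := by
  have h1 := integral_cond_map_fst_le (b := binomial N q) (b' := b') s
    (integrable_binomial (fun x : ℕ => ((x : ℝ) - N * q) ^ 2))
    (fun x => by positivity) (by norm_num) hs
  rw [(binomial_central_moments N q).2.1, hv] at h1
  linarith

/-- Some a in [Nq - 3w, Nq - w/8] has binomial mass at least (1/20)/(4w), and masses increase from a
up to the mean. There Y lies to the right of every window point with probability at least 1/20. -/
lemma binomialCondLE_window (hq : (q : ℝ) < 1) (hw : 32 ≤ w) (hw' : 1 ≤ w')
    (hv : N * (q : ℝ) * (1 - q) = w ^ 2)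
    (hv' : N' * (q' : ℝ) * (1 - q') = w' ^ 2) (hd : |N * (q : ℝ) - N' * q'| ≤ w' / 8) :
    ∃ a D : ℕ, w / 32 ≤ D ∧
      ∀ j < 2 * D, 1 / (1600 * w) ≤ (binomialCondLE N N' q q').real {a + j} := by
  rw [abs_le] at hd
  obtain ⟨a, ha1, ha2, ha3⟩ := exists_le_measureReal_singleton _ (by norm_num)
    (le_binomial_left_of_mean N q (by linarith) hv)
  have hD1 : (⌊w / 16⌋₊ : ℝ) ≤ w / 16 := Nat.floor_le (by linarith)
  have hD2 := Nat.lt_floor_add_one (w / 16)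
  -- The window has length at most w/8, so it stays left of the mean; w ≥ 32 makes the floor at
  -- least w/32.
  refine ⟨a, ⌊w / 16⌋₊, by linarith, fun j hj => ?_⟩
  have hj' : (j : ℝ) ≤ 2 * ⌊w / 16⌋₊ := by exact_mod_cast hj.le
  have haj : (a : ℝ) + j ≤ N * q := by linarith
  refine le_trans ?_ (mul_le_cond_map_fst_real _ _)
  have h1 : 1 / (80 * w) ≤ (binomial N q).real {a + j} := by
    refine le_trans ?_ (ha3.trans (binomial_real_le_add hq j haj))
    rw [div_div, div_le_div_iff₀ (by linarith) (by nlinarith)]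
    linarith
  have h2 : 1 / 20 ≤ (binomial N' q').real {y | (a + j, y) ∈ {z : ℕ × ℕ | z.1 ≤ z.2}} := by
    refine (le_binomial_right_of_mean N' q' hw' hv').trans (measureReal_mono ?_)
    rintro y ⟨hy, -⟩
    have : ((a + j : ℕ) : ℝ) ≤ y := by push_cast; linarith
    exact_mod_cast this
  calc 1 / (1600 * w) = 1 / (80 * w) * (1 / 20) := by field_simp; norm_num
    _ ≤ _ := mul_le_mul h1 h2 (by norm_num) measureReal_nonneg

lemma binomialCondGT_window (hq : (q : ℝ) < 1) (hw : 32 ≤ w) (hw' : 1 ≤ w')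
    (hv : N * (q : ℝ) * (1 - q) = w ^ 2)
    (hv' : N' * (q' : ℝ) * (1 - q') = w' ^ 2) (hd : |N * (q : ℝ) - N' * q'| ≤ w' / 8) :
    ∃ a D : ℕ, w / 32 ≤ D ∧
      ∀ j < 2 * D, 1 / (1600 * w) ≤ (binomialCondGT N N' q q').real {a + j} := by
  rw [abs_le] at hd
  obtain ⟨a, ha1, ha2, ha3⟩ := exists_le_measureReal_singleton _ (by norm_num)
    (le_binomial_right_of_mean N q (by linarith) hv)
  have hD1 : (⌊w / 16⌋₊ : ℝ) ≤ w / 16 := Nat.floor_le (by linarith)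
  have hD2 := Nat.lt_floor_add_one (w / 16)
  have hNq : 0 ≤ N * (q : ℝ) := mul_nonneg N.cast_nonneg q.2.1
  have hDa : 2 * ⌊w / 16⌋₊ ≤ a := by
    have : 2 * (⌊w / 16⌋₊ : ℝ) ≤ a := by linarith
    exact_mod_cast this
  -- The window now ends exactly at a, to the right of the mean, where masses decrease; the +1 also
  -- keeps its points strictly above Nq, as Y < X requires.
  refine ⟨a + 1 - 2 * ⌊w / 16⌋₊, ⌊w / 16⌋₊, by linarith, fun j hj => ?_⟩
  obtain ⟨i, hi⟩ : ∃ i, a = (a + 1 - 2 * ⌊w / 16⌋₊ + j) + i :=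
    ⟨a - (a + 1 - 2 * ⌊w / 16⌋₊ + j), by omega⟩
  set c := a + 1 - 2 * ⌊w / 16⌋₊ + j with hc
  have hcr : (a : ℝ) + 1 - 2 * ⌊w / 16⌋₊ ≤ c := by
    have : a + 1 ≤ c + 2 * ⌊w / 16⌋₊ := by omega
    have : (a : ℝ) + 1 ≤ c + 2 * ⌊w / 16⌋₊ := by exact_mod_cast this
    linarith
  refine le_trans ?_ (mul_le_cond_map_fst_real _ _)
  have h1 : 1 / (80 * w) ≤ (binomial N q).real {c} := by
    have h3 := binomial_real_add_le hq i (show N * (q : ℝ) ≤ c by linarith)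
    rw [← hi] at h3
    refine le_trans ?_ (ha3.trans h3)
    rw [div_div, div_le_div_iff₀ (by linarith) (by nlinarith)]
    linarith
  have h2 : 1 / 20 ≤ (binomial N' q').real {y | (c, y) ∈ {z : ℕ × ℕ | z.1 > z.2}} := by
    refine (le_binomial_left_of_mean N' q' hw' hv').trans (measureReal_mono ?_)
    rintro y ⟨-, hy⟩
    have : (y : ℝ) < c := by linarith
    exact_mod_cast this
  calc 1 / (1600 * w) = 1 / (80 * w) * (1 / 20) := by field_simp; norm_num
    _ ≤ _ := mul_le_mul h1 h2 (by norm_num) measureReal_nonneg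

lemma binomial_real_singleton_pos {k : ℕ} (hk : k ≤ N) (h0 : 0 < (q : ℝ)) (h1 : (q : ℝ) < 1) :
    0 < (binomial N q).real {k} := by
  rw [binomial_real_singleton]
  have : 0 < 1 - (q : ℝ) := by linarith
  have : 0 < N.choose k := Nat.choose_pos hk
  positivity

/-- Two adjacent atoms suffice for positive variance, so that division by σ is meaningful for every
admissible n. -/
lemma binomialCondLE_exists_pos (hN : 2 ≤ N) (hN' : 2 ≤ N') (h0 : 0 < (q : ℝ)) (h1 : (q : ℝ) < 1)
    (h0' : 0 < (q' : ℝ)) (h1' : (q' : ℝ) < 1) :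
    ∃ a : ℕ, ∃ η : ℝ, 0 < η ∧ ∀ j < 2 * 1, η ≤ (binomialCondLE N N' q q').real {a + j} := by
  have key : ∀ j < 2, 0 < (binomialCondLE N N' q q').real {0 + j} := by
    intro j hj
    refine lt_of_lt_of_le ?_ (mul_le_cond_map_fst_real _ _)
    refine mul_pos (binomial_real_singleton_pos (by omega) h0 h1) ?_
    refine (binomial_real_singleton_pos hN' h0' h1').trans_le (measureReal_mono ?_)
    rintro y rfl
    simp only [Set.mem_ofPred_eq]
    omega
  exact ⟨0, min _ _, lt_min (key 0 (by norm_num)) (key 1 (by norm_num)), fun j hj => by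
    interval_cases j
    · exact min_le_left _ _
    · exact min_le_right _ _⟩

lemma binomialCondGT_exists_pos (hN : 2 ≤ N) (h0 : 0 < (q : ℝ)) (h1 : (q : ℝ) < 1)
    (h0' : 0 < (q' : ℝ)) (h1' : (q' : ℝ) < 1) :
    ∃ a : ℕ, ∃ η : ℝ, 0 < η ∧ ∀ j < 2 * 1, η ≤ (binomialCondGT N N' q q').real {a + j} := by
  have key : ∀ j < 2, 0 < (binomialCondGT N N' q q').real {1 + j} := by
    intro j hj
    refine lt_of_lt_of_le ?_ (mul_le_cond_map_fst_real _ _)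
    refine mul_pos (binomial_real_singleton_pos (by omega) h0 h1) ?_
    refine (binomial_real_singleton_pos N'.zero_le h0' h1').trans_le (measureReal_mono ?_)
    rintro y rfl
    simp only [Set.mem_ofPred_eq]
    omega
  exact ⟨1, min _ _, lt_min (key 0 (by norm_num)) (key 1 (by norm_num)), fun j hj => by
    interval_cases j
    · exact min_le_left _ _
    · exact min_le_right _ _⟩

end

/-! ### Transfer from laws to random variables -/

section

variable {Ω : Type*} [MeasurableSpace Ω] {P : Measure Ω} {X : Ω → ℕ} {Q : Measure ℕ}

lemma ProbabilityTheory.HasLaw.memLp_three_natCast (hX : HasLaw X Q P)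
    (hQ : ∀ f : ℕ → ℝ, Integrable f Q) : MemLp (fun ω => (X ω : ℝ)) 3 P := by
  have hm : AEStronglyMeasurable (fun x : ℕ => (x : ℝ)) Q :=
    (measurable_of_countable _).aestronglyMeasurable
  have h1 : MemLp (fun x : ℕ => (x : ℝ)) 3 Q := by
    rw [← integrable_norm_rpow_iff hm (by norm_num) (by norm_num)]
    exact hQ _
  rw [← hX.map_eq] at h1 hm
  exact (memLp_map_measure_iff hm hX.aemeasurable).1 h1

lemma ProbabilityTheory.HasLaw.integral_nat_eq (hX : HasLaw X Q P) (f : ℕ → ℝ) :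
    ∫ ω, f (X ω) ∂P = ∫ x, f x ∂Q :=
  hX.integral_comp (f := f) (measurable_of_countable _).aestronglyMeasurable

lemma variance_natCast_le [IsProbabilityMeasure P] (hX : HasLaw X Q P) (c : ℝ) :
    variance (fun ω => (X ω : ℝ)) P ≤ ∫ x : ℕ, ((x : ℝ) - c) ^ 2 ∂Q := by
  have hm : AEMeasurable (fun ω => (X ω : ℝ)) P :=
    (measurable_of_countable (fun x : ℕ => (x : ℝ))).comp_aemeasurable hX.aemeasurable
  rw [← variance_sub_const hm.aestronglyMeasurable c,
    ← hX.integral_nat_eq (fun x => ((x : ℝ) - c) ^ 2)]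
  exact variance_le_expectation_sq (hm.sub_const c).aestronglyMeasurable

lemma le_variance_natCast (hX : HasLaw X Q P) (hQ : ∀ f : ℕ → ℝ, Integrable f Q)
    {a D : ℕ} {η : ℝ} (hη0 : 0 ≤ η) (hη : ∀ j < 2 * D, η ≤ Q.real {a + j}) :
    η * D ^ 3 / 2 ≤ variance (fun ω => (X ω : ℝ)) P := by
  have hm : AEMeasurable (fun ω => (X ω : ℝ)) P :=
    (measurable_of_countable (fun x : ℕ => (x : ℝ))).comp_aemeasurable hX.aemeasurable
  rw [variance_eq_integral hm,
    hX.integral_nat_eq (fun x => ((x : ℝ) - ∫ ω, (X ω : ℝ) ∂P) ^ 2)]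
  exact le_integral_sub_sq_nat Q hη0 hη _ (hQ _)

lemma norm_charFun_map_natCast_le [IsProbabilityMeasure P] (hX : HasLaw X Q P) {a D : ℕ} {η : ℝ} (hη0 : 0 ≤ η)
    (hη : ∀ j < 2 * D, η ≤ Q.real {a + j}) {e : ℝ} (he : e = 1 ∨ e = -1) (m : ℝ) {t : ℝ}
    (ht : |t| ≤ Real.pi) :
    ‖charFun (P.map fun ω => e * ((X ω : ℝ) - m)) t‖ ≤
      1 - η * D * min 1 ((D * t / Real.pi) ^ 2) := by
  have hQp : IsProbabilityMeasure Q := hX.isProbabilityMeasure_iff.1 inferInstance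
  have hg : Measurable fun x : ℕ => e * ((x : ℝ) - m) := measurable_of_countable _
  have h1 : charFun (P.map fun ω => e * ((X ω : ℝ) - m)) t =
      Complex.exp (((-(t * e * m) : ℝ) : ℂ) * Complex.I) *
        ∫ x : ℕ, Complex.exp (((t * e : ℝ) : ℂ) * x * Complex.I) ∂Q := by
    have hgX : AEMeasurable (fun ω => e * ((X ω : ℝ) - m)) P := hg.comp_aemeasurable hX.aemeasurable
    rw [charFun_apply_real, integral_map hgX (by fun_prop),
      ← hX.integral_comp (measurable_of_countable _).aestronglyMeasurable, ← integral_const_mul]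
    congr 1
    ext ω
    rw [Function.comp_apply, ← Complex.exp_add]
    congr 1
    push_cast
    ring
  have he2 : e ^ 2 = 1 := by rcases he with rfl | rfl <;> norm_num
  have hea : |e| = 1 := by rcases he with rfl | rfl <;> norm_num
  rw [h1, norm_mul, Complex.norm_exp_ofReal_mul_I, one_mul]
  refine (norm_integral_cexp_nat_le Q hη0 hη (t := t * e) ?_).trans (le_of_eq ?_)
  · rw [abs_mul, hea, mul_one]; exact ht
  · rw [show (D * (t * e) / Real.pi) ^ 2 = (D * t / Real.pi) ^ 2 * e ^ 2 by ring, he2, mul_one]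

end

/-! ### The local limit theorem for signed sums -/

section

variable {Ω : Type*} [MeasurableSpace Ω] {P : Measure Ω} [IsProbabilityMeasure P]
  {M : ℕ} {X : Fin M → Ω → ℕ} {Q : Fin M → Measure ℕ} {ε : Fin M → ℤ}

lemma variance_signedSum (hind : iIndepFun X P) (hX : ∀ k, HasLaw (X k) (Q k) P)
    (hQ : ∀ k (f : ℕ → ℝ), Integrable f (Q k)) (hε : ∀ k, ε k = 1 ∨ ε k = -1) :
    variance (fun ω => (signedSum ε X ω : ℝ)) P =
      ∑ k, variance (fun ω => (X k ω : ℝ)) P := by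
  have h1 : (fun ω => (signedSum ε X ω : ℝ)) = ∑ k, fun ω => (ε k : ℝ) * (X k ω : ℝ) := by
    ext ω
    simp [signedSum]
  rw [h1, IndepFun.variance_sum]
  · refine Finset.sum_congr rfl fun k _ => ?_
    rw [variance_const_mul]
    rcases hε k with h | h <;> simp [h]
  · exact fun k _ => (((hX k).memLp_three_natCast (hQ k)).mono_exponent (by norm_num)).const_mul _
  · intro j _ k _ hjk
    exact (hind.indepFun hjk).comp (φ := fun x : ℕ => (ε j : ℝ) * (x : ℝ))
      (ψ := fun x : ℕ => (ε k : ℝ) * (x : ℝ)) (measurable_of_countable _)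
      (measurable_of_countable _)

lemma charFun_signedSum_sub (hind : iIndepFun X P) (hX : ∀ k, HasLaw (X k) (Q k) P)
    (hQ : ∀ k (f : ℕ → ℝ), Integrable f (Q k)) (t : ℝ) :
    charFun (P.map fun ω => (signedSum ε X ω : ℝ) - ∫ ω', (signedSum ε X ω' : ℝ) ∂P) t =
      ∏ k, charFun (P.map fun ω => (ε k : ℝ) * ((X k ω : ℝ) - ∫ ω', (X k ω' : ℝ) ∂P)) t := by
  have hi : ∀ k, Integrable (fun ω => (X k ω : ℝ)) P := fun k =>
    ((hX k).memLp_three_natCast (hQ k)).integrable (by norm_num)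
  have h1 : (fun ω => (signedSum ε X ω : ℝ) - ∫ ω', (signedSum ε X ω' : ℝ) ∂P) =
      fun ω => ∑ k, (ε k : ℝ) * ((X k ω : ℝ) - ∫ ω', (X k ω' : ℝ) ∂P) := by
    ext ω
    simp only [signedSum]
    push_cast
    rw [integral_finsetSum _ fun k _ => (hi k).const_mul _, ← Finset.sum_sub_distrib]
    exact Finset.sum_congr rfl fun k _ => by rw [integral_const_mul]; ring
  have h2 := hind.comp (fun k (x : ℕ) => (ε k : ℝ) * ((x : ℝ) - ∫ ω', (X k ω' : ℝ) ∂P))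
    (fun k => measurable_of_countable _)
  have h3 := h2.charFun_map_fun_sum_eq_prod (fun k =>
    (measurable_of_countable _).comp_aemeasurable (hX k).aemeasurable)
  rw [h1]
  have := congrFun h3 t
  rw [Finset.prod_apply] at this
  exact this

/-- A quantitative local limit theorem for sums of independent integer variables whose laws all
contain a long flat piece. -/
theorem abs_measureReal_signedSum_sub_gaussian_le (hind : iIndepFun X P)
    (hX : ∀ k, HasLaw (X k) (Q k) P) (hQ : ∀ k (f : ℕ → ℝ), Integrable f (Q k))
    (hε : ∀ k, ε k = 1 ∨ ε k = -1) {c : Fin M → ℝ} {β V κ D T : ℝ}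
    (hβ : ∀ k, ∫ x : ℕ, |(x : ℝ) - c k| ^ 3 ∂(Q k) ≤ β)
    (hV : ∀ k, ∫ x : ℕ, ((x : ℝ) - c k) ^ 2 ∂(Q k) ≤ V) (hD0 : 0 ≤ D)
    (hwin : ∀ k, ∃ a Dk : ℕ, ∃ η : ℝ, 0 ≤ η ∧ D ≤ Dk ∧ κ ≤ η * Dk ∧
      ∀ j < 2 * Dk, η ≤ (Q k).real {a + j})
    (hT : 0 < T) (hTpi : T ≤ Real.pi) {σ : ℝ}
    (hσ : σ = √(variance (fun ω => (signedSum ε X ω : ℝ)) P)) (hσ0 : 0 < σ) (s : ℤ) :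
    |P.real {ω | signedSum ε X ω = s} - 1 / (√(2 * Real.pi) * σ) *
      Real.exp (-((s : ℝ) - ∫ ω, (signedSum ε X ω : ℝ) ∂P) ^ 2 / (2 * σ ^ 2))| ≤
      T * (M * (32 * T ^ 3 * β + V ^ 2 * T ^ 4)) +
        Real.exp (-(M * (κ * min 1 ((D * T / Real.pi) ^ 2)))) +
        Real.exp (-σ ^ 2 * T ^ 2 / 4) / σ := by
  set μ := ∫ ω, (signedSum ε X ω : ℝ) ∂P with hμ
  set m : Fin M → ℝ := fun k => ∫ ω, (X k ω : ℝ) ∂P with hm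
  set ψ : ℝ → ℂ := charFun (P.map fun ω => (signedSum ε X ω : ℝ) - μ) with hψ
  set v : Fin M → ℝ := fun k => variance (fun ω => (X k ω : ℝ)) P with hv
  have hSm : AEMeasurable (signedSum ε X) P := by
    unfold signedSum
    refine Finset.aemeasurable_fun_sum _ fun k _ => ?_
    exact (measurable_of_countable (fun x : ℕ => ε k * (x : ℤ))).comp_aemeasurable
      (hX k).aemeasurable
  have hSm' : AEMeasurable (fun ω => (signedSum ε X ω : ℝ) - μ) P :=
    (measurable_of_countable (fun x : ℤ => (x : ℝ) - μ)).comp_aemeasurable hSm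
  have hPS : IsProbabilityMeasure (P.map fun ω => (signedSum ε X ω : ℝ) - μ) :=
    Measure.isProbabilityMeasure_map hSm'
  have hσ2 : σ ^ 2 = ∑ k, v k := by
    rw [hσ, Real.sq_sqrt (variance_nonneg _ _), variance_signedSum hind hX hQ hε]
  have hψprod : ∀ t, ψ t = ∏ k, charFun (P.map fun ω => (ε k : ℝ) * ((X k ω : ℝ) - m k)) t :=
    fun t => charFun_signedSum_sub hind hX hQ t
  have hεr : ∀ k, (ε k : ℝ) = 1 ∨ (ε k : ℝ) = -1 := by
    intro k; rcases hε k with h | h <;> simp [h]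
  have hZ : ∀ k, MemLp (fun ω => (ε k : ℝ) * ((X k ω : ℝ) - m k)) 3 P := fun k =>
    (((hX k).memLp_three_natCast (hQ k)).sub (memLp_const _)).const_mul _
  have hZ0 : ∀ k, ∫ ω, (ε k : ℝ) * ((X k ω : ℝ) - m k) ∂P = 0 := by
    intro k
    rw [integral_const_mul, integral_sub
      (((hX k).memLp_three_natCast (hQ k)).integrable (by norm_num)) (integrable_const _)]
    simp [hm]
  have hZ2 : ∀ k, ∫ ω, ((ε k : ℝ) * ((X k ω : ℝ) - m k)) ^ 2 ∂P = v k := by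
    intro k
    have h1 : (ε k : ℝ) ^ 2 = 1 := by rcases hεr k with h | h <;> simp [h]
    simp_rw [mul_pow, h1, one_mul]
    exact (variance_eq_integral ((hX k).memLp_three_natCast (hQ k)).1.aemeasurable).symm
  have hZ3 : ∀ k, ∫ ω, |(ε k : ℝ) * ((X k ω : ℝ) - m k)| ^ 3 ∂P ≤ 8 * β := by
    intro k
    have h1 : |(ε k : ℝ)| = 1 := by rcases hεr k with h | h <;> simp [h]
    simp_rw [abs_mul, h1, one_mul]
    refine (integral_abs_sub_integral_pow_three_le
      ((hX k).memLp_three_natCast (hQ k)) (c k)).trans ?_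
    rw [(hX k).integral_nat_eq (fun x => |(x : ℝ) - c k| ^ 3)]
    linarith [hβ k]
  have hvV : ∀ k, v k ≤ V := fun k => (variance_natCast_le (hX k) (c k)).trans (hV k)
  have hv0 : ∀ k, 0 ≤ v k := fun k => variance_nonneg _ _
  -- The constant 32 is 4 from the Taylor bound times 8 from recentring at the true mean.
  have h1 : ∀ t : ℝ, |t| ≤ T → ‖ψ t - (Real.exp (-σ ^ 2 * t ^ 2 / 2) : ℝ)‖ ≤
      M * (32 * T ^ 3 * β + V ^ 2 * T ^ 4) := by
    intro t ht
    have e : ((Real.exp (-σ ^ 2 * t ^ 2 / 2) : ℝ) : ℂ) =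
        ∏ k, ((Real.exp (-(v k) * t ^ 2 / 2) : ℝ) : ℂ) := by
      rw [← Complex.ofReal_prod, ← Real.exp_sum, hσ2]
      congr 2
      rw [← Finset.sum_div, ← Finset.sum_mul, Finset.sum_neg_distrib]
    rw [hψprod, e]
    refine (norm_prod_sub_prod_le_sum _ (fun k _ => ?_) (fun k _ => ?_)).trans ?_
    · have : IsProbabilityMeasure (P.map fun ω => (ε k : ℝ) * ((X k ω : ℝ) - m k)) :=
        Measure.isProbabilityMeasure_map (hZ k).1.aemeasurable
      exact norm_charFun_le_one t
    · rw [Complex.norm_real, Real.norm_of_nonneg (Real.exp_pos _).le, Real.exp_le_one_iff]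
      have : 0 ≤ v k * t ^ 2 := mul_nonneg (hv0 k) (sq_nonneg t)
      linarith
    · have hk : ∀ k ∈ Finset.univ,
          ‖charFun (P.map fun ω => (ε k : ℝ) * ((X k ω : ℝ) - m k)) t -
            ((Real.exp (-(v k) * t ^ 2 / 2) : ℝ) : ℂ)‖ ≤ 32 * T ^ 3 * β + V ^ 2 * T ^ 4 := by
        intro k _
        have h2 := norm_charFun_sub_exp_le (hZ k) (hZ0 k) t
        rw [hZ2] at h2
        refine h2.trans ?_
        have h3 : 4 * |t| ^ 3 * ∫ ω, |(ε k : ℝ) * ((X k ω : ℝ) - m k)| ^ 3 ∂P ≤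
            4 * T ^ 3 * (8 * β) := by
          refine mul_le_mul (by gcongr) (hZ3 k) ?_ (by positivity)
          exact integral_nonneg fun _ => by positivity
        have h4 : v k ^ 2 * t ^ 4 ≤ V ^ 2 * T ^ 4 := by
          have e4 : t ^ 4 = |t| ^ 4 := by rw [pow_abs, abs_of_nonneg (by positivity)]
          rw [e4]
          have := hvV k
          have := hv0 k
          gcongr
        linarith
      refine (Finset.sum_le_sum hk).trans (le_of_eq ?_)
      rw [Finset.sum_const, Finset.card_univ, Fintype.card_fin, nsmul_eq_mul]
  have h2 : ∀ t : ℝ, T ≤ |t| → |t| ≤ Real.pi → ‖ψ t‖ ≤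
      Real.exp (-(M * (κ * min 1 ((D * T / Real.pi) ^ 2)))) := by
    intro t htT htpi
    rw [hψprod, norm_prod]
    have hk : ∀ k ∈ Finset.univ, ‖charFun (P.map fun ω => (ε k : ℝ) * ((X k ω : ℝ) - m k)) t‖ ≤
        Real.exp (-(κ * min 1 ((D * T / Real.pi) ^ 2))) := by
      intro k _
      obtain ⟨a, Dk, η, hη0, hDk, hκ, hη⟩ := hwin k
      refine (norm_charFun_map_natCast_le (hX k) hη0 hη (hεr k) (m k) htpi).trans ?_
      have h3 : min 1 ((D * T / Real.pi) ^ 2) ≤ min 1 ((Dk * t / Real.pi) ^ 2) := by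
        refine min_le_min le_rfl ?_
        rw [← sq_abs (Dk * t / Real.pi), abs_div, abs_mul, Nat.abs_cast,
          abs_of_pos Real.pi_pos]
        have := Real.pi_pos
        gcongr
      have h4 : 0 ≤ min 1 ((D * T / Real.pi) ^ 2) := by positivity
      have h5 : κ * min 1 ((D * T / Real.pi) ^ 2) ≤ η * Dk * min 1 ((Dk * t / Real.pi) ^ 2) := by
        refine mul_le_mul hκ h3 h4 (by positivity)
      have := Real.add_one_le_exp (-(κ * min 1 ((D * T / Real.pi) ^ 2)))
      linarith
    refine (Finset.prod_le_prod (fun _ _ => norm_nonneg _) hk).trans (le_of_eq ?_)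
    rw [Finset.prod_const, Finset.card_univ, Fintype.card_fin, ← Real.exp_nat_mul]
    congr 1
    ring
  have h3 := norm_integral_sub_gaussian_le (continuous_charFun
    (μ := P.map fun ω => (signedSum ε X ω : ℝ) - μ)) hσ0 hT hTpi
    (Real.exp_pos _).le h1 h2 (s - μ)
  rw [← Real.norm_eq_abs, ← Complex.norm_real]
  refine le_trans (le_of_eq ?_) h3
  rw [Complex.ofReal_sub, measureReal_eq_integral_charFun P hSm μ s]
  push_cast
  rfl

end

/-! ### Numerical bounds for the error terms and the parameters -/

lemma exp_neg_le_const_div_pow {r y : ℝ} (hr : 0 < r) (hy : r ^ 8 / 1024000 ≤ y) :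
    Real.exp (-y) ≤ (Nat.factorial 15 * 1024000 ^ 15) / r ^ 120 := by
  have hz : 0 < r ^ 8 / 1024000 := by positivity
  have h1 := Real.pow_div_factorial_le_exp _ hz.le 15
  have h2 : Real.exp (-y) ≤ Real.exp (-(r ^ 8 / 1024000)) := Real.exp_le_exp.2 (by linarith)
  refine h2.trans ?_
  rw [Real.exp_neg]
  have hf : (0 : ℝ) < Nat.factorial 15 := by positivity
  refine (inv_anti₀ (by positivity) h1).trans (le_of_eq ?_)
  rw [div_pow, ← pow_mul]
  field_simp

/-- Here r = n^(1/100), T = r^(-95), D = r^49. The three terms are of order r^(-130), exp(-c r^8)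
and exp(-c r^8)/σ; taking the 15th term of the exponential series turns r^8 into r^120. -/
lemma local_limit_error_le {r M σ : ℝ} (hr : 1 ≤ r) (hM : r ^ 100 / 2 ≤ M) (hM' : M ≤ 2 * r ^ 100)
    (hσ0 : 0 < σ) (hσ : σ ^ 2 ≤ M * (400 * r ^ 100))
    (hσ' : M * (1 / 51200 * (r ^ 49) ^ 2 / 2) ≤ σ ^ 2) :
    (r ^ 95)⁻¹ * (M * (32 * (r ^ 95)⁻¹ ^ 3 * (1000 * r ^ 150) +
        (400 * r ^ 100) ^ 2 * (r ^ 95)⁻¹ ^ 4)) +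
      Real.exp (-(M * (1 / 51200 * min 1 ((r ^ 49 * (r ^ 95)⁻¹ / Real.pi) ^ 2)))) +
      Real.exp (-σ ^ 2 * (r ^ 95)⁻¹ ^ 2 / 4) / σ ≤
    (11520000 + 31 * (Nat.factorial 15 * 1024000 ^ 15)) / (r ^ 20 * σ) := by
  have hr0 : 0 < r := by linarith
  set K : ℝ := Nat.factorial 15 * 1024000 ^ 15 with hK
  have hK0 : 0 < K := by positivity
  have hσ30 : σ ≤ 30 * r ^ 100 := by
    refine le_of_sq_le_sq ?_ (by positivity)
    calc σ ^ 2 ≤ M * (400 * r ^ 100) := hσ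
      _ ≤ 2 * r ^ 100 * (400 * r ^ 100) := by gcongr
      _ ≤ (30 * r ^ 100) ^ 2 := by nlinarith [pow_pos hr0 100]
  have hM0 : 0 ≤ M := le_trans (by positivity) hM
  -- Since σ ≤ 30 r^100, an error of r^(-120) is already of the required size.
  have hbase : 1 / r ^ 120 ≤ 30 / (r ^ 20 * σ) := by
    rw [div_le_div_iff₀ (by positivity) (by positivity)]
    calc 1 * (r ^ 20 * σ) ≤ 1 * (r ^ 20 * (30 * r ^ 100)) := by gcongr
      _ = _ := by ring
  have t1 : (r ^ 95)⁻¹ * (M * (32 * (r ^ 95)⁻¹ ^ 3 * (1000 * r ^ 150) +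
        (400 * r ^ 100) ^ 2 * (r ^ 95)⁻¹ ^ 4)) ≤ 11520000 / (r ^ 20 * σ) := by
    have e1 : 32 * (r ^ 95)⁻¹ ^ 3 * (1000 * r ^ 150) = 32000 / r ^ 135 := by
      field_simp; norm_num
    have e2 : (400 * r ^ 100) ^ 2 * (r ^ 95)⁻¹ ^ 4 = 160000 / r ^ 180 := by
      field_simp; norm_num
    have e3 : (160000 : ℝ) / r ^ 180 ≤ 160000 / r ^ 135 := by
      gcongr
      norm_num
    rw [e1, e2]
    calc _ ≤ (r ^ 95)⁻¹ * (2 * r ^ 100 * (32000 / r ^ 135 + 160000 / r ^ 135)) := by gcongr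
      _ = 384000 / r ^ 130 := by field_simp; norm_num
      _ ≤ 384000 / r ^ 120 := by
        gcongr
        norm_num
      _ = 384000 * (1 / r ^ 120) := by ring
      _ ≤ 384000 * (30 / (r ^ 20 * σ)) := by gcongr
      _ = _ := by ring
  have t2 : Real.exp (-(M * (1 / 51200 * min 1 ((r ^ 49 * (r ^ 95)⁻¹ / Real.pi) ^ 2)))) ≤
      30 * K / (r ^ 20 * σ) := by
    have h1 : 1 / (10 * r ^ 92) ≤ min 1 ((r ^ 49 * (r ^ 95)⁻¹ / Real.pi) ^ 2) := by
      refine le_min ?_ ?_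
      · rw [div_le_one (by positivity)]
        nlinarith [one_le_pow₀ hr (n := 92)]
      · have e : (r ^ 49 * (r ^ 95)⁻¹ / Real.pi) ^ 2 = 1 / (Real.pi ^ 2 * r ^ 92) := by
          have := Real.pi_pos
          field_simp
        rw [e]
        have : Real.pi ^ 2 ≤ 10 := by
          nlinarith [Real.pi_lt_d2, Real.pi_pos]
        have := Real.pi_pos
        gcongr
    have h2 : r ^ 8 / 1024000 ≤ M * (1 / 51200 * min 1 ((r ^ 49 * (r ^ 95)⁻¹ / Real.pi) ^ 2)) := by
      calc r ^ 8 / 1024000 = r ^ 100 / 2 * (1 / 51200 * (1 / (10 * r ^ 92))) := by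
            field_simp; norm_num
        _ ≤ _ := by gcongr
    calc _ ≤ K / r ^ 120 := exp_neg_le_const_div_pow hr0 h2
      _ = K * (1 / r ^ 120) := by ring
      _ ≤ K * (30 / (r ^ 20 * σ)) := by gcongr
      _ = _ := by ring
  have t3 : Real.exp (-σ ^ 2 * (r ^ 95)⁻¹ ^ 2 / 4) / σ ≤ K / (r ^ 20 * σ) := by
    have h2 : r ^ 8 / 1024000 ≤ σ ^ 2 * (r ^ 95)⁻¹ ^ 2 / 4 := by
      calc r ^ 8 / 1024000 ≤ r ^ 8 / 819200 := by gcongr; norm_num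
        _ = (r ^ 100 / 2 * (1 / 51200 * (r ^ 49) ^ 2 / 2)) * (r ^ 95)⁻¹ ^ 2 / 4 := by
            field_simp; norm_num
        _ ≤ _ := by
          gcongr
          exact (mul_le_mul_of_nonneg_right hM (by positivity)).trans hσ'
    have h3 := exp_neg_le_const_div_pow hr0 h2
    rw [show -σ ^ 2 * (r ^ 95)⁻¹ ^ 2 / 4 = -(σ ^ 2 * (r ^ 95)⁻¹ ^ 2 / 4) by ring, ← div_div]
    gcongr
    refine h3.trans ?_
    gcongr
    norm_num
  calc _ ≤ 11520000 / (r ^ 20 * σ) + 30 * K / (r ^ 20 * σ) + K / (r ^ 20 * σ) := by linarith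
    _ = _ := by ring

/-- With l = (log n)^(1/8) all powers of log n become integral powers of l. A nonempty range for p
forces l² ≥ 2, hence log n ≥ 16. -/
lemma log_rpow_eighth_facts {n : ℕ} {p : ℝ} (hn : 2 ≤ n)
    (h1 : Real.log n ^ (-(1 / 4) : ℝ) ≤ p) (h2 : p ≤ 1 - Real.log n ^ (-(1 / 4) : ℝ)) :
    1 ≤ Real.log n ^ (1 / 8 : ℝ) ∧ (Real.log n ^ (1 / 8 : ℝ)) ^ 8 = Real.log n ∧
      Real.log n ^ (1 / 4 : ℝ) = (Real.log n ^ (1 / 8 : ℝ)) ^ 2 ∧ (1000000 : ℝ) ≤ n ∧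
      (Real.log n ^ (1 / 8 : ℝ)) ^ 16 ≤ 4 * n ∧
      1 / (2 * (Real.log n ^ (1 / 8 : ℝ)) ^ 2) ≤ p * (1 - p) ∧ 0 < p ∧ p < 1 := by
  have hn1 : (1 : ℝ) < n := by exact_mod_cast hn
  have hL : 0 < Real.log n := Real.log_pos hn1
  set l := Real.log n ^ (1 / 8 : ℝ) with hl
  have hl0 : 0 < l := Real.rpow_pos_of_pos hL _
  have e8 : l ^ 8 = Real.log n := by
    rw [hl, ← Real.rpow_natCast, ← Real.rpow_mul hL.le]; norm_num
  have e2 : Real.log n ^ (1 / 4 : ℝ) = l ^ 2 := by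
    rw [hl, ← Real.rpow_natCast, ← Real.rpow_mul hL.le]; norm_num
  have e3 : Real.log n ^ (-(1 / 4) : ℝ) = 1 / l ^ 2 := by
    rw [Real.rpow_neg hL.le, e2, one_div]
  rw [e3] at h1 h2
  have hl2 : 2 ≤ l ^ 2 := by
    have : 1 / l ^ 2 ≤ 1 / 2 := by linarith
    exact (one_div_le_one_div (by positivity) (by norm_num)).1 this
  have hl1 : 1 ≤ l := by nlinarith
  have h16 : 16 ≤ Real.log n := by
    rw [← e8, show l ^ 8 = (l ^ 2) ^ 4 by ring]
    calc (16 : ℝ) = 2 ^ 4 := by norm_num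
      _ ≤ _ := by gcongr
  have hbig : (1000000 : ℝ) ≤ n := by
    rw [← Real.exp_log (by linarith : (0 : ℝ) < n)]
    calc (1000000 : ℝ) ≤ 2.7 ^ 16 := by norm_num
      _ ≤ Real.exp 1 ^ 16 := by
        have := Real.exp_one_gt_d9
        gcongr
        linarith
      _ = Real.exp 16 := by rw [← Real.exp_nat_mul]; norm_num
      _ ≤ _ := Real.exp_le_exp.2 h16
  refine ⟨hl1, e8, e2, hbig, ?_, ?_, lt_of_lt_of_le (by positivity) h1, ?_⟩
  · have hs : Real.log n ≤ 2 * √n := by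
      have h3 := Real.log_le_sub_one_of_pos (Real.sqrt_pos.2 (by linarith : (0 : ℝ) < n))
      rw [Real.log_sqrt (by linarith)] at h3
      linarith
    have : l ^ 16 = Real.log n ^ 2 := by rw [← e8]; ring
    rw [this]
    calc Real.log n ^ 2 ≤ (2 * √n) ^ 2 := by gcongr
      _ = _ := by rw [mul_pow, Real.sq_sqrt (by linarith)]; norm_num
  · have e : 1 / (2 * l ^ 2) = 1 / l ^ 2 / 2 := by field_simp
    rw [e]
    have : 0 < 1 / l ^ 2 := by positivity
    rcases le_total p (1 / 2) with h | h
    · nlinarith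
    · nlinarith
  · have : 0 < 1 / l ^ 2 := by positivity
    linarith

/-- The deviation |q - p| is at most p(1 - p)/2, so q ≥ p/2 and 1 - q ≥ (1 - p)/2. -/
lemma success_prob_bounds {n l L p q : ℝ} (hl : 1 ≤ l) (hL : l ^ 8 = L) (hn : 1000000 ≤ n)
    (hln : l ^ 16 ≤ 4 * n) (hP : 1 / (2 * l ^ 2) ≤ p * (1 - p)) (hp0 : 0 < p) (hp1 : p < 1)
    (hq : |q - p| ≤ 40 * √(p * (1 - p) * L) / n) :
    0 < q ∧ q < 1 ∧ 1 / (8 * l ^ 2) ≤ q * (1 - q) ∧ n * |q - p| ≤ 20 * l ^ 4 := by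
  have hn0 : 0 < n := by linarith
  have hl0 : 0 < l := by linarith
  have hP0 : 0 < p * (1 - p) := mul_pos hp0 (by linarith)
  have hPq : p * (1 - p) ≤ 1 / 4 := by nlinarith [sq_nonneg (p - 1 / 2)]
  have h1 : n * |q - p| ≤ 40 * √(p * (1 - p) * L) := by
    rw [le_div_iff₀ hn0] at hq; linarith
  have h2 : √(p * (1 - p) * L) ≤ l ^ 4 / 2 := by
    rw [Real.sqrt_le_left (by positivity), ← hL]
    calc p * (1 - p) * l ^ 8 ≤ 1 / 4 * l ^ 8 := by gcongr
      _ = _ := by ring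
  have h3 : |q - p| ≤ p * (1 - p) / 2 := by
    refine hq.trans ?_
    rw [div_le_iff₀ hn0]
    have : √(p * (1 - p) * L) ≤ p * (1 - p) * n / 80 := by
      rw [Real.sqrt_le_left (by positivity), ← hL]
      have h4 : 6400 * l ^ 8 ≤ p * (1 - p) * n ^ 2 := by
        calc 6400 * l ^ 8 = 1 / (2 * l ^ 2) * (12800 * l ^ 10) := by field_simp; norm_num
          _ ≤ p * (1 - p) * n ^ 2 := by
            gcongr
            calc 12800 * l ^ 10 ≤ 12800 * l ^ 16 := by
                  gcongr
                  norm_num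
              _ ≤ 12800 * (4 * n) := by gcongr
              _ ≤ n ^ 2 := by nlinarith
      calc p * (1 - p) * l ^ 8 = p * (1 - p) * (6400 * l ^ 8) / 6400 := by ring
        _ ≤ p * (1 - p) * (p * (1 - p) * n ^ 2) / 6400 := by gcongr
        _ = _ := by ring
    linarith
  rw [abs_le] at h3
  have hqlo : p / 2 ≤ q := by nlinarith
  have hqhi : (1 - p) / 2 ≤ 1 - q := by nlinarith
  refine ⟨by linarith, by linarith, ?_, by linarith⟩
  calc 1 / (8 * l ^ 2) = 1 / (2 * l ^ 2) / 4 := by field_simp; norm_num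
    _ ≤ p * (1 - p) / 4 := by gcongr
    _ = p / 2 * ((1 - p) / 2) := by ring
    _ ≤ q * (1 - q) := mul_le_mul hqlo hqhi (by linarith) (by linarith)

lemma toNat_add_bounds {n : ℕ} {t : ℤ} {l : ℝ} (hl : 1 ≤ l) (hn : (1000000 : ℝ) ≤ n)
    (hln : l ^ 16 ≤ 4 * n) (ht : |(t : ℝ)| ≤ 2 * l ^ 2) :
    ((((n : ℤ) + t).toNat : ℕ) : ℝ) = n + t ∧ (n : ℝ) / 2 ≤ ((((n : ℤ) + t).toNat : ℕ) : ℝ) ∧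
      ((((n : ℤ) + t).toNat : ℕ) : ℝ) ≤ 3 / 2 * n := by
  have h1 : l ^ 2 ≤ n / 4 := by
    refine le_of_sq_le_sq ?_ (by positivity)
    calc (l ^ 2) ^ 2 = l ^ 4 := by ring
      _ ≤ l ^ 16 := pow_le_pow_right₀ hl (by norm_num)
      _ ≤ 4 * n := hln
      _ ≤ (n / 4) ^ 2 := by nlinarith
  rw [abs_le] at ht
  have h2 : (0 : ℤ) ≤ n + t := by
    have : (0 : ℝ) ≤ n + t := by linarith
    exact_mod_cast this
  have h3 : ((((n : ℤ) + t).toNat : ℕ) : ℝ) = n + t := by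
    have := Int.toNat_of_nonneg h2
    exact_mod_cast congrArg (Int.cast (R := ℝ)) this
  rw [h3]
  exact ⟨rfl, by linarith, by linarith⟩

lemma integral_sq_cond_map_fst_le {N : ℕ} {q : unitInterval} {b' : Measure ℕ}
    [IsProbabilityMeasure b'] {s : Set (ℕ × ℕ)}
    [IsProbabilityMeasure ((ProbabilityTheory.cond ((binomial N q).prod b') s).map Prod.fst)] :
    ∫ x : ℕ, ((x : ℝ) - 0) ^ 2 ∂((ProbabilityTheory.cond ((binomial N q).prod b') s).map Prod.fst) ≤
      (N : ℝ) ^ 2 := by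
  have h1 : ∀ᵐ x ∂(binomial N q), x ≤ N := ae_le_of_hasLaw_binomial (X := id) HasLaw.id
  have h2 : ∀ᵐ z ∂((binomial N q).prod b'), z.1 ≤ N := Measure.quasiMeasurePreserving_fst.ae h1
  have h3 : ∀ᵐ z ∂(ProbabilityTheory.cond ((binomial N q).prod b') s), z.1 ≤ N :=
    cond_absolutelyContinuous.ae_le h2
  have h4 : ∀ᵐ x ∂((ProbabilityTheory.cond ((binomial N q).prod b') s).map Prod.fst), x ≤ N := by
    rw [ae_map_iff measurable_fst.aemeasurable (by measurability)]
    exact h3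
  refine (integral_mono_ae (integrable_cond_map_fst s (integrable_binomial _))
    (integrable_const ((N : ℝ) ^ 2)) ?_).trans (le_of_eq (by simp))
  filter_upwards [h4] with x hx
  have : (x : ℝ) ≤ N := by exact_mod_cast hx
  simp only [sub_zero]
  gcongr

/-! ### Uniform estimates for both conditioned laws -/

section

variable {N N' : ℕ} {q q' : unitInterval} {ρ : Measure ℕ}

lemma integrable_binomialCond
    (hR : ρ = binomialCondLE N N' q q' ∨ ρ = binomialCondGT N N' q q') (f : ℕ → ℝ) :
    Integrable f ρ := by
  rcases hR with rfl | rfl <;> exact integrable_cond_map_fst _ (integrable_binomial f)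

lemma integral_sq_binomialCond_le [IsProbabilityMeasure ρ]
    (hR : ρ = binomialCondLE N N' q q' ∨ ρ = binomialCondGT N N' q q') :
    ∫ x : ℕ, ((x : ℝ) - 0) ^ 2 ∂ρ ≤ (N : ℝ) ^ 2 := by
  rcases hR with rfl | rfl
  · unfold binomialCondLE at *
    exact integral_sq_cond_map_fst_le
  · unfold binomialCondGT at *
    exact integral_sq_cond_map_fst_le

lemma binomialCond_exists_pos
    (hR : ρ = binomialCondLE N N' q q' ∨ ρ = binomialCondGT N N' q q') (hN : 2 ≤ N) (hN' : 2 ≤ N')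
    (h0 : 0 < (q : ℝ)) (h1 : (q : ℝ) < 1) (h0' : 0 < (q' : ℝ)) (h1' : (q' : ℝ) < 1) :
    ∃ a : ℕ, ∃ η : ℝ, 0 < η ∧ ∀ j < 2 * 1, η ≤ ρ.real {a + j} := by
  rcases hR with rfl | rfl
  · exact binomialCondLE_exists_pos hN hN' h0 h1 h0' h1'
  · exact binomialCondGT_exists_pos hN h0 h1 h0' h1'

lemma binomialCond_estimates
    (hR : ρ = binomialCondLE N N' q q' ∨ ρ = binomialCondGT N N' q q')
    (hq : (q : ℝ) < 1) {d r : ℝ} (hd1 : 1 ≤ d) (hdr : (32 * d) ^ 2 ≤ N * (q : ℝ) * (1 - q))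
    (hr0 : 0 < r) (hr : N * (q : ℝ) * (1 - q) ≤ r ^ 2)
    (hdr' : (32 * d) ^ 2 ≤ N' * (q' : ℝ) * (1 - q'))
    (hd : |N * (q : ℝ) - N' * q'| ≤ 4 * d) :
    ∫ x : ℕ, |(x : ℝ) - N * q| ^ 3 ∂ρ ≤ 1000 * r ^ 3 ∧
    ∫ x : ℕ, ((x : ℝ) - N * q) ^ 2 ∂ρ ≤ 400 * r ^ 2 ∧
    ∃ a D : ℕ, ∃ η : ℝ, 0 ≤ η ∧ d ≤ D ∧ 1 / 51200 ≤ η * D ∧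
      ∀ j < 2 * D, η ≤ ρ.real {a + j} := by
  set w := √(N * (q : ℝ) * (1 - q)) with hwdef
  set w' := √(N' * (q' : ℝ) * (1 - q')) with hwdef'
  have hv : N * (q : ℝ) * (1 - q) = w ^ 2 := (Real.sq_sqrt (le_trans (by positivity) hdr)).symm
  have hv' : N' * (q' : ℝ) * (1 - q') = w' ^ 2 :=
    (Real.sq_sqrt (le_trans (by positivity) hdr')).symm
  have hw : 32 * d ≤ w := Real.le_sqrt_of_sq_le hdr
  have hw' : 32 * d ≤ w' := Real.le_sqrt_of_sq_le hdr'
  have hwr : w ≤ r := Real.sqrt_le_iff.2 ⟨hr0.le, hr⟩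
  have hw0 : 0 < w := by linarith
  have hdw : |N * (q : ℝ) - N' * q'| ≤ w' / 8 := by linarith
  have hprob : ∃ s : Set (ℕ × ℕ),
      ρ = (ProbabilityTheory.cond ((binomial N q).prod (binomial N' q')) s).map Prod.fst ∧
      1 / 400 ≤ ((binomial N q).prod (binomial N' q')).real s := by
    rcases hR with rfl | rfl
    · exact ⟨_, rfl, le_prod_binomial_le (by linarith) (by linarith) hv hv' hdw⟩
    · exact ⟨_, rfl, le_prod_binomial_gt (by linarith) (by linarith) hv hv' hdw⟩
  have hwin : ∃ a D : ℕ, w / 32 ≤ D ∧ ∀ j < 2 * D, 1 / (1600 * w) ≤ ρ.real {a + j} := by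
    rcases hR with rfl | rfl
    · exact binomialCondLE_window hq (by linarith) (by linarith) hv hv' hdw
    · exact binomialCondGT_window hq (by linarith) (by linarith) hv hv' hdw
  obtain ⟨s, hRs, hs⟩ := hprob
  refine ⟨?_, ?_, ?_⟩
  · rw [hRs]
    refine (integral_abs_sub_pow_three_cond_map_fst_le (by linarith) hv hs).trans ?_
    gcongr
  · rw [hRs]
    refine (integral_sub_sq_cond_map_fst_le hv hs).trans ?_
    gcongr
  · obtain ⟨a, D, hD, hη⟩ := hwin
    refine ⟨a, D, 1 / (1600 * w), by positivity, by linarith, ?_, hη⟩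
    calc (1 / 51200 : ℝ) = 1 / (1600 * w) * (w / 32) := by field_simp; norm_num
      _ ≤ _ := by gcongr

end

/-! ### Choice of parameters and conclusion -/

lemma exists_forall_log_rpow_le :
    ∃ n₀ : ℕ, ∀ n : ℕ, n₀ ≤ n → 128 * Real.log n ^ (1 / 8 : ℝ) ≤ (n : ℝ) ^ (1 / 100 : ℝ) := by
  have h := (isLittleO_log_rpow_rpow_atTop (1 / 8 : ℝ) (show (0 : ℝ) < 1 / 100 by norm_num)).bound
    (show (0 : ℝ) < 1 / 128 by norm_num)
  obtain ⟨n₀, hn₀⟩ := Filter.eventually_atTop.1 (tendsto_natCast_atTop_atTop.eventually h)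
  refine ⟨n₀, fun n hn => ?_⟩
  have h1 := hn₀ n hn
  have h2 : 0 ≤ Real.log n := Real.log_natCast_nonneg n
  rw [Real.norm_of_nonneg (by positivity), Real.norm_of_nonneg (by positivity)] at h1
  linarith

lemma abs_measureReal_sub_gaussian_le_one_add {Ω : Type*} [MeasurableSpace Ω] (P : Measure Ω)
    [IsProbabilityMeasure P] (A : Set Ω) {σ : ℝ} (hσ : 0 < σ) (x : ℝ) :
    |P.real A - 1 / (√(2 * Real.pi) * σ) * Real.exp (-x ^ 2 / (2 * σ ^ 2))| ≤ 1 + 1 / σ := by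
  have h1 : P.real A ≤ 1 := measureReal_le_one
  have h2 : 0 ≤ P.real A := measureReal_nonneg
  have h3 : 1 ≤ √(2 * Real.pi) := Real.one_le_sqrt.2 (by linarith [Real.pi_gt_three])
  have h4 : 1 / (√(2 * Real.pi) * σ) ≤ 1 / σ := by
    apply one_div_le_one_div_of_le hσ
    nlinarith
  have h5 : Real.exp (-x ^ 2 / (2 * σ ^ 2)) ≤ 1 := by
    rw [Real.exp_le_one_iff]
    exact div_nonpos_of_nonpos_of_nonneg (by nlinarith [sq_nonneg x]) (by positivity)
  have h6 : 1 / (√(2 * Real.pi) * σ) * Real.exp (-x ^ 2 / (2 * σ ^ 2)) ≤ 1 / σ * 1 := by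
    gcongr
  have h7 : 0 ≤ 1 / (√(2 * Real.pi) * σ) * Real.exp (-x ^ 2 / (2 * σ ^ 2)) := by positivity
  rw [abs_le]
  constructor <;> linarith

/-- The number of summands matters only up to constants, so M is any integer between n/2 and 3n/2.
-/
lemma exists_const_abs_measureReal_signedSum_sub_gaussian_le :
    ∃ C : ℝ, 0 < C ∧
      ∀ (n M : ℕ) (τ τ' : Fin M → ℤ) (p : ℝ) (q q' : Fin M → unitInterval) (i : ℕ)
        (ε : Fin M → ℤ),
        2 ≤ n → (n : ℝ) / 2 ≤ M → (M : ℝ) ≤ 3 / 2 * n →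
        (∀ k, |(τ k : ℝ)| ≤ 2 * Real.log n ^ (1 / 4 : ℝ)) →
        (∀ k, |(τ' k : ℝ)| ≤ 2 * Real.log n ^ (1 / 4 : ℝ)) →
        Real.log n ^ (-(1 / 4) : ℝ) ≤ p →
        p ≤ 1 - Real.log n ^ (-(1 / 4) : ℝ) →
        (∀ k, |(q k : ℝ) - p| ≤ 40 * √(p * (1 - p) * Real.log n) / n) →
        (∀ k, |(q' k : ℝ) - p| ≤ 40 * √(p * (1 - p) * Real.log n) / n) →
        (∀ k, ε k = 1 ∨ ε k = -1) →
        ∀ (Ω : Type*) [MeasurableSpace Ω] (P : Measure Ω) [IsProbabilityMeasure P]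
          (X : Fin M → Ω → ℕ),
          iIndepFun X P →
          (∀ k : Fin M, (k : ℕ) < i → HasLaw (X k)
            (binomialCondLE ((n : ℤ) + τ k).toNat ((n : ℤ) + τ' k).toNat (q k) (q' k)) P) →
          (∀ k : Fin M, i ≤ (k : ℕ) → HasLaw (X k)
            (binomialCondGT ((n : ℤ) + τ k).toNat ((n : ℤ) + τ' k).toNat (q k) (q' k)) P) →
          ∀ μS σS : ℝ,
            μS = ∫ ω, (signedSum ε X ω : ℝ) ∂P →
            σS = √(variance (fun ω => (signedSum ε X ω : ℝ)) P) →
            ∀ s : ℤ,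
              |P.real {ω | signedSum ε X ω = s}
                  - 1 / (√(2 * Real.pi) * σS)
                    * Real.exp (-((s : ℝ) - μS) ^ 2 / (2 * σS ^ 2))|
                ≤ C / ((n : ℝ) ^ (1 / 5 : ℝ) * σS) := by
  obtain ⟨n₀, hn₀⟩ := exists_forall_log_rpow_le
  -- The first summand covers n < n₀, where the trivial bound 1 + 1/σ and σ ≤ 3n² suffice; the
  -- second covers n ≥ n₀.
  refine ⟨n₀ * (3 * n₀ ^ 2 + 1) + (11520000 + 31 * (Nat.factorial 15 * 1024000 ^ 15)),
    by positivity, ?_⟩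
  intro n M τ τ' p q q' i ε hn hM1 hM2 hτ hτ' hp1 hp2 hq hq' hε Ω _ P _ X hind hLE hGT μS σS
    hμ hσ s
  obtain ⟨hl, hl8, hl2, hbig, hl16, hP, hp0, hp1⟩ := log_rpow_eighth_facts hn hp1 hp2
  simp_rw [hl2] at hτ hτ'
  set l := Real.log n ^ (1 / 8 : ℝ) with hldef
  have hn0 : (0 : ℝ) < n := by linarith
  have hN := fun k => toNat_add_bounds hl hbig hl16 (hτ k)
  have hN' := fun k => toNat_add_bounds hl hbig hl16 (hτ' k)
  have hqb := fun k => success_prob_bounds hl hl8 hbig hl16 hP hp0 hp1 (hq k)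
  have hqb' := fun k => success_prob_bounds hl hl8 hbig hl16 hP hp0 hp1 (hq' k)
  set N : Fin M → ℕ := fun k => ((n : ℤ) + τ k).toNat with hNdef
  set N' : Fin M → ℕ := fun k => ((n : ℤ) + τ' k).toNat with hNdef'
  set Q : Fin M → Measure ℕ := fun k =>
    if (k : ℕ) < i then binomialCondLE (N k) (N' k) (q k) (q' k)
    else binomialCondGT (N k) (N' k) (q k) (q' k) with hQdef
  have hR : ∀ k, Q k = binomialCondLE (N k) (N' k) (q k) (q' k) ∨
      Q k = binomialCondGT (N k) (N' k) (q k) (q' k) := by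
    intro k
    simp only [hQdef]
    split_ifs
    · exact Or.inl rfl
    · exact Or.inr rfl
  have hX : ∀ k, HasLaw (X k) (Q k) P := by
    intro k
    simp only [hQdef]
    split_ifs with h
    · exact hLE k h
    · exact hGT k (not_lt.1 h)
  have hQp : ∀ k, IsProbabilityMeasure (Q k) := fun k =>
    (hX k).isProbabilityMeasure_iff.1 inferInstance
  have hQi : ∀ k (f : ℕ → ℝ), Integrable f (Q k) := fun k f => integrable_binomialCond (hR k) f
  have hvar := variance_signedSum hind hX hQi hε
  have hσ2 : σS ^ 2 = ∑ k, variance (fun ω => (X k ω : ℝ)) P := by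
    rw [hσ, Real.sq_sqrt (variance_nonneg _ _), hvar]
  have hN2 : ∀ k, 2 ≤ N k := by
    intro k
    have : (2 : ℝ) ≤ N k := by linarith [(hN k).2.1]
    exact_mod_cast this
  have hN2' : ∀ k, 2 ≤ N' k := by
    intro k
    have : (2 : ℝ) ≤ N' k := by linarith [(hN' k).2.1]
    exact_mod_cast this
  have hvpos : ∀ k, 0 < variance (fun ω => (X k ω : ℝ)) P := by
    intro k
    obtain ⟨a, η, hη0, hη⟩ := binomialCond_exists_pos (hR k) (hN2 k) (hN2' k)
      (hqb k).1 (hqb k).2.1 (hqb' k).1 (hqb' k).2.1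
    have := le_variance_natCast (hX k) (hQi k) hη0.le hη
    have : 0 < η * ((1 : ℕ) : ℝ) ^ 3 / 2 := by positivity
    linarith
  have hM0 : 0 < M := by
    have : (0 : ℝ) < M := by linarith
    exact_mod_cast this
  have hσ0 : 0 < σS := by
    rw [hσ, hvar]
    refine Real.sqrt_pos.2 (Finset.sum_pos (fun k _ => hvpos k) ⟨⟨0, hM0⟩, Finset.mem_univ _⟩)
  have hsum : ∀ V, (∀ k, variance (fun ω => (X k ω : ℝ)) P ≤ V) → σS ^ 2 ≤ M * V := by
    intro V hV
    rw [hσ2]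
    refine (Finset.sum_le_sum fun k _ => hV k).trans (le_of_eq ?_)
    rw [Finset.sum_const, Finset.card_univ, Fintype.card_fin, nsmul_eq_mul]
  have hsum' : ∀ V, (∀ k, V ≤ variance (fun ω => (X k ω : ℝ)) P) → M * V ≤ σS ^ 2 := by
    intro V hV
    rw [hσ2]
    refine le_trans (le_of_eq ?_) (Finset.sum_le_sum fun k _ => hV k)
    rw [Finset.sum_const, Finset.card_univ, Fintype.card_fin, nsmul_eq_mul]
  have hn15 : 0 < (n : ℝ) ^ (1 / 5 : ℝ) := by positivity
  rcases lt_or_ge n n₀ with hlt | hge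
  · refine (abs_measureReal_sub_gaussian_le_one_add P _ hσ0 (s - μS)).trans ?_
    have h1 : σS ^ 2 ≤ (3 * (n : ℝ) ^ 2) ^ 2 := by
      have h2 : ∀ k, variance (fun ω => (X k ω : ℝ)) P ≤ (3 / 2 * (n : ℝ)) ^ 2 := by
        intro k
        refine (variance_natCast_le (hX k) 0).trans ((integral_sq_binomialCond_le (hR k)).trans ?_)
        have : (N k : ℝ) ≤ 3 / 2 * n := (hN k).2.2
        gcongr
      calc σS ^ 2 ≤ M * (3 / 2 * (n : ℝ)) ^ 2 := hsum _ h2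
        _ ≤ 3 / 2 * n * (3 / 2 * (n : ℝ)) ^ 2 := by gcongr
        _ = 27 / 8 * (n : ℝ) ^ 3 := by ring
        _ ≤ 9 * (n : ℝ) ^ 4 := by
          have : (n : ℝ) ^ 3 ≤ (n : ℝ) ^ 4 := pow_le_pow_right₀ (by linarith) (by norm_num)
          have : (0 : ℝ) ≤ (n : ℝ) ^ 3 := by positivity
          linarith
        _ = _ := by ring
    have h2 : σS ≤ 3 * (n : ℝ) ^ 2 := le_of_sq_le_sq h1 (by positivity)
    have h3 : (n : ℝ) ^ (1 / 5 : ℝ) ≤ n := by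
      calc (n : ℝ) ^ (1 / 5 : ℝ) ≤ (n : ℝ) ^ (1 : ℝ) :=
            Real.rpow_le_rpow_of_exponent_le (by linarith) (by norm_num)
        _ = n := Real.rpow_one _
    have h4 : (n : ℝ) ≤ n₀ := by exact_mod_cast hlt.le
    rw [le_div_iff₀ (by positivity)]
    calc (1 + 1 / σS) * ((n : ℝ) ^ (1 / 5 : ℝ) * σS) = (n : ℝ) ^ (1 / 5 : ℝ) * (σS + 1) := by
          field_simp
      _ ≤ n * (3 * (n : ℝ) ^ 2 + 1) := by gcongr
      _ ≤ n₀ * (3 * (n₀ : ℝ) ^ 2 + 1) := by gcongr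
      _ ≤ _ := by
        have : (0 : ℝ) ≤ 11520000 + 31 * (Nat.factorial 15 * 1024000 ^ 15) := by positivity
        linarith
  · set r := (n : ℝ) ^ (1 / 100 : ℝ) with hr
    have hr0 : 0 < r := by positivity
    have hlr : 128 * l ≤ r := hn₀ n hge
    have hr1 : 1 ≤ r := by linarith
    have hr100 : r ^ 100 = n := by
      rw [hr, ← Real.rpow_natCast, ← Real.rpow_mul hn0.le]; norm_num
    have hr20 : (n : ℝ) ^ (1 / 5 : ℝ) = r ^ 20 := by
      rw [hr, ← Real.rpow_natCast, ← Real.rpow_mul hn0.le]; norm_num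
    -- The variance is at least n/(16 l²), and 128² = 32² · 16: the requirement 128 l ≤ r absorbs
    -- the logarithmic loss into r².
    have hvlow : ∀ (K : ℕ) (x : unitInterval), (n : ℝ) / 2 ≤ K →
        1 / (8 * l ^ 2) ≤ (x : ℝ) * (1 - x) → (32 * r ^ 49) ^ 2 ≤ K * (x : ℝ) * (1 - x) := by
      intro K x hK hx
      calc (32 * r ^ 49) ^ 2 = r ^ 98 * (128 * l) ^ 2 * (1 / (16 * l ^ 2)) := by
            field_simp; ring
        _ ≤ r ^ 98 * r ^ 2 * (1 / (16 * l ^ 2)) := by gcongr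
        _ = n / 2 * (1 / (8 * l ^ 2)) := by rw [← hr100]; field_simp; norm_num
        _ ≤ K * ((x : ℝ) * (1 - x)) := by gcongr
        _ = _ := by ring
    have hvhigh : ∀ (K : ℕ) (x : unitInterval), (K : ℝ) ≤ 3 / 2 * n →
        K * (x : ℝ) * (1 - x) ≤ (r ^ 50) ^ 2 := by
      intro K x hK
      have hx : (x : ℝ) * (1 - x) ≤ 1 / 4 := by nlinarith [sq_nonneg ((x : ℝ) - 1 / 2)]
      calc K * (x : ℝ) * (1 - x) = K * ((x : ℝ) * (1 - x)) := by ring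
        _ ≤ K * (1 / 4) := by gcongr
        _ ≤ n := by linarith
        _ = _ := by rw [← hr100]; ring
    -- The means differ by at most 40 l⁴ + 4 l², a power of log n, far below r^49.
    have hdiff : ∀ k, |N k * (q k : ℝ) - N' k * q' k| ≤ 4 * r ^ 49 := by
      intro k
      have e : N k * (q k : ℝ) - N' k * q' k =
          n * (q k - p) - n * (q' k - p) + (τ k * q k - τ' k * q' k) := by
        rw [(hN k).1, (hN' k).1]; ring
      have a1 : |(n : ℝ) * (q k - p)| ≤ 20 * l ^ 4 := by
        rw [abs_mul, Nat.abs_cast]; exact (hqb k).2.2.2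
      have a2 : |(n : ℝ) * (q' k - p)| ≤ 20 * l ^ 4 := by
        rw [abs_mul, Nat.abs_cast]; exact (hqb' k).2.2.2
      have a3 : |(τ k : ℝ) * q k| ≤ 2 * l ^ 2 := by
        rw [abs_mul, abs_of_nonneg (q k).2.1]
        exact (mul_le_of_le_one_right (abs_nonneg _) (q k).2.2).trans (hτ k)
      have a4 : |(τ' k : ℝ) * q' k| ≤ 2 * l ^ 2 := by
        rw [abs_mul, abs_of_nonneg (q' k).2.1]
        exact (mul_le_of_le_one_right (abs_nonneg _) (q' k).2.2).trans (hτ' k)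
      have a5 : l ^ 2 ≤ l ^ 4 := pow_le_pow_right₀ hl (by norm_num)
      have a6 : (128 * l) ^ 4 ≤ r ^ 49 := calc
        (128 * l) ^ 4 ≤ r ^ 4 := by gcongr
        _ ≤ r ^ 49 := pow_le_pow_right₀ hr1 (by norm_num)
      have a7 : 0 ≤ l ^ 4 := by positivity
      rw [mul_pow] at a6
      rw [abs_le] at a1 a2 a3 a4 ⊢
      rw [e]
      constructor <;> linarith
    have hest := fun k => binomialCond_estimates (hR k) (hqb k).2.1 (one_le_pow₀ hr1 (n := 49))
      (hvlow _ _ (hN k).2.1 (hqb k).2.2.1) (by positivity : 0 < r ^ 50) (hvhigh _ _ (hN k).2.2)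
      (hvlow _ _ (hN' k).2.1 (hqb' k).2.2.1) (hdiff k)
    have e3 : (r ^ 50) ^ 3 = r ^ 150 := by ring
    have e2 : (r ^ 50) ^ 2 = r ^ 100 := by ring
    simp_rw [e3, e2] at hest
    have hT1 : (r ^ 95)⁻¹ ≤ 1 := inv_le_one_of_one_le₀ (one_le_pow₀ hr1)
    have hmain := abs_measureReal_signedSum_sub_gaussian_le hind hX hQi hε
      (fun k => (hest k).1) (fun k => (hest k).2.1) (by positivity : 0 ≤ r ^ 49)
      (fun k => (hest k).2.2) (by positivity : 0 < (r ^ 95)⁻¹)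
      (by linarith [Real.pi_gt_three]) hσ hσ0 s
    rw [← hμ] at hmain
    refine hmain.trans ?_
    have hup : σS ^ 2 ≤ M * (400 * r ^ 100) := hsum _ fun k =>
      (variance_natCast_le (hX k) _).trans (hest k).2.1
    have hlow : M * (1 / 51200 * (r ^ 49) ^ 2 / 2) ≤ σS ^ 2 := by
      refine hsum' _ fun k => ?_
      obtain ⟨a, D, η, hη0, hD, hκ, hη⟩ := (hest k).2.2
      refine le_trans ?_ (le_variance_natCast (hX k) (hQi k) hη0 hη)
      calc 1 / 51200 * (r ^ 49) ^ 2 / 2 ≤ η * D * (D : ℝ) ^ 2 / 2 := by gcongr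
        _ = _ := by ring
    refine (local_limit_error_le hr1 (by rw [hr100]; exact hM1) (by rw [hr100]; linarith) hσ0
      hup hlow).trans ?_
    rw [hr20]
    have : (0 : ℝ) ≤ n₀ * (3 * (n₀ : ℝ) ^ 2 + 1) := by positivity
    exact div_le_div_of_nonneg_right (le_add_of_nonneg_left this) (by positivity)

/-- The summand number `k + 1` has index `k : Fin (n + m).toNat`, so that the first `i` summands
are those with `k < i`. -/
theorem mainTheorem5 :
    ∃ C : ℝ, 0 < C ∧
      ∀ (n : ℕ) (m : ℤ) (τ τ' : Fin ((n : ℤ) + m).toNat → ℤ) (p : ℝ)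
        (q q' : Fin ((n : ℤ) + m).toNat → unitInterval)
        (i : ℕ) (ε : Fin ((n : ℤ) + m).toNat → ℤ),
        2 ≤ n →
        |(m : ℝ)| ≤ 2 * Real.log n ^ (1 / 4 : ℝ) →
        (∀ k, |(τ k : ℝ)| ≤ 2 * Real.log n ^ (1 / 4 : ℝ)) →
        (∀ k, |(τ' k : ℝ)| ≤ 2 * Real.log n ^ (1 / 4 : ℝ)) →
        Real.log n ^ (-(1 / 4) : ℝ) ≤ p →
        p ≤ 1 - Real.log n ^ (-(1 / 4) : ℝ) →
        (∀ k, |(q k : ℝ) - p| ≤ 40 * √(p * (1 - p) * Real.log n) / n) →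
        (∀ k, |(q' k : ℝ) - p| ≤ 40 * √(p * (1 - p) * Real.log n) / n) →
        1 ≤ i → (i : ℤ) ≤ n + m →
        (∀ k, ε k = 1 ∨ ε k = -1) →
        ∀ (Ω : Type*) [MeasurableSpace Ω] (P : Measure Ω) [IsProbabilityMeasure P]
          (X : Fin ((n : ℤ) + m).toNat → Ω → ℕ),
          iIndepFun X P →
          (∀ k : Fin ((n : ℤ) + m).toNat, (k : ℕ) < i → HasLaw (X k)
            (binomialCondLE ((n : ℤ) + τ k).toNat ((n : ℤ) + τ' k).toNat (q k) (q' k)) P) →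
          (∀ k : Fin ((n : ℤ) + m).toNat, i ≤ (k : ℕ) → HasLaw (X k)
            (binomialCondGT ((n : ℤ) + τ k).toNat ((n : ℤ) + τ' k).toNat (q k) (q' k)) P) →
          ∀ μS σS : ℝ,
            μS = ∫ ω, (signedSum ε X ω : ℝ) ∂P →
            σS = √(variance (fun ω => (signedSum ε X ω : ℝ)) P) →
            ∀ s : ℤ,
              |P.real {ω | signedSum ε X ω = s}
                  - 1 / (√(2 * Real.pi) * σS)
                    * Real.exp (-((s : ℝ) - μS) ^ 2 / (2 * σS ^ 2))|
                ≤ C / ((n : ℝ) ^ (1 / 5 : ℝ) * σS) := by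
  obtain ⟨C, hC, h⟩ := exists_const_abs_measureReal_signedSum_sub_gaussian_le
  refine ⟨C, hC, ?_⟩
  intro n m τ τ' p q q' i ε hn hm hτ hτ' hp1 hp2 hq hq' _ _ hε Ω _ P _ X hind hLE hGT
  obtain ⟨hl, -, hl2, hbig, hl16, -⟩ := log_rpow_eighth_facts hn hp1 hp2
  rw [hl2] at hm
  obtain ⟨-, hM1, hM2⟩ := toNat_add_bounds hl hbig hl16 hm
  exact h n _ τ τ' p q q' i ε hn hM1 hM2 hτ hτ' hp1 hp2 hq hq' hε Ω P X hind hLE hGT
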